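/- Let $L_{\mathcal O}=\{+,-,0,\mathcal O\}$, with $\mathcal O$ a ternary relation symbol. An \emph{oriented abelian group} is an abelian group $A$ with a ternary relation $\mathcal O$ such that (i) $\mathcal O(a,b,c)$ implies $\mathcal O(b,c,a)$; (ii) $\mathcal O(a,b,c)$ implies $\mathcal O(a+d,b+d,c+d)$; (iii) the relation $x<_0y :\Leftrightarrow \mathcal O(0,x,y)$ holds only between nonzero elements and is a strict linear order on $A\setminus\{0\}$. It is \emph{regularly dense} if for every prime $p$ and all $a,b\in A$ with $\mathcal O(0,a,b)$ there is $c\in A$ with $\mathcal O(a,pc,b)$ and $ic<_0(i+1)c$ for all $i\in\{1,\dots,p-1\}$. For a prime $p$ put $[p]A=|A/pA|$ and $\operatorname{Tor}_{p^k}(A)=\{x\in A: p^kx=0\}$, and let $e(A,p)$ be the least $k\in\mathbb N$ such that $\operatorname{Tor}_{p^{k+m}}(A)=\operatorname{Tor}_{p^k}(A)$ for all $m\in\mathbb N$, with $e(A,p)=\infty$ if there is no such $k$. For sequences $\vec d=(d_p)_p$ and $\vec e=(e_p)_p$ in $\mathbb N\cup\{\infty\}$ indexed by the primes, let $T(\vec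 d,\vec e)$ be the $L_{\mathcal O}$-theory whose models are the regularly dense oriented abelian groups $A$ with $[p]A=p^{d_p}$ (read as: $A/pA$ is infinite, if $d_p=\infty$) and $e(A,p)=e_p$ for every prime $p$. In particular $T(\vec 0,\vec e)$ is a theory of divisible groups. An \emph{ICT-pattern} in a structure $M$ consists of formulas $\varphi(x;\vec y)$ and $\psi(x;\vec z)$, where $x$ is a single variable, and sequences $(\vec a_i)_{i\in\mathbb N}$, $(\vec b_j)_{j\in\mathbb N}$ of tuples from $M$ of lengths $|\vec y|$ and $|\vec z|$, such that for all $i,j\in\mathbb N$ the set of formulas $$\{\varphi(x;\vec a_i),\ \psi(x;\vec b_j)\}\cup\{\neg\varphi(x;\vec a_k):k\neq i\}\cup\{\neg\psi(x;\vec b_l):l\neq j\}$$ is consistent, that is, finitely satisfiable in $M$. A theory is \emph{dp-minimal} if no model of it has an ICT-pattern. \textbf{Corollary.} Let $\vec e$ be either the sequence $\vec 0$ with all terms $0$ or the sequence $\vec\infty$ with all terms $\infty$. Then the $L_{\mathcal O}$-theory $T(\vec 0,\vec e)$ is dp-minimal. -/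

import Mathlib

open FirstOrder FirstOrder.Language

universe w

/-! ### dp-minimality -/

namespace FirstOrder.Language

/-- `φ(x; y)`, `ψ(x; z)` with `x` a single variable and `y`, `z` finite tuples, together with the
sequences `a`, `b` of parameter tuples from `M`, form an ICT-pattern in `M`: for all `i`, `j` the
set of formulas
`{φ(x; a i), ψ(x; b j)} ∪ {¬ φ(x; a k) : k ≠ i} ∪ {¬ ψ(x; b l) : l ≠ j}`
is consistent with the elementary diagram of `M`, that is, finitely satisfiable in `M`. -/
def IsICTPattern {L : Language} {M : Type*} [L.Structure M] {m n : ℕ}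
    (φ : L.Formula (Unit ⊕ Fin m)) (ψ : L.Formula (Unit ⊕ Fin n))
    (a : ℕ → Fin m → M) (b : ℕ → Fin n → M) : Prop :=
  ∀ i j : ℕ, ∀ s : Finset ℕ, ∃ x : M,
    φ.Realize (Sum.elim (fun _ => x) (a i)) ∧
    ψ.Realize (Sum.elim (fun _ => x) (b j)) ∧
    (∀ k ∈ s, k ≠ i → ¬ φ.Realize (Sum.elim (fun _ => x) (a k))) ∧
    (∀ l ∈ s, l ≠ j → ¬ ψ.Realize (Sum.elim (fun _ => x) (b l)))

/-- A theory is dp-minimal if no model of it has an ICT-pattern. -/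
def Theory.DPMinimal.{u, v, w'} {L : Language.{u, v}} (T : L.Theory) : Prop :=
  ∀ (M : Type w') [L.Structure M], M ⊨ T →
    ¬ ∃ (m n : ℕ) (φ : L.Formula (Unit ⊕ Fin m)) (ψ : L.Formula (Unit ⊕ Fin n))
      (a : ℕ → Fin m → M) (b : ℕ → Fin n → M), IsICTPattern φ ψ a b

end FirstOrder.Language

/-! ### The language of oriented abelian groups -/

namespace OrientedGroup

inductive Func : ℕ → Type
  | zero : Func 0
  | neg : Func 1
  | add : Func 2

inductive Rel : ℕ → Type
  | orient : Rel 3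

/-- The language `L_O = {+, -, 0, O}`, with `-` unary and `O` ternary. -/
def lang : FirstOrder.Language.{0, 0} where
  Functions := Func
  Relations := Rel

section Terms

variable {α : Type*}

instance : Zero (lang.Term α) where
  zero := Constants.term (L := lang) Func.zero

instance : Neg (lang.Term α) where
  neg := Functions.apply₁ (L := lang) Func.neg

instance : Add (lang.Term α) where
  add := Functions.apply₂ (L := lang) Func.add

/-- The term `k • t = t + ⋯ + t`. -/
instance : SMul ℕ (lang.Term α) where
  smul := nsmulRec

/-- The atomic formula `O(t₁, t₂, t₃)`. -/
def orient {n : ℕ} (t₁ t₂ t₃ : lang.Term (α ⊕ Fin n)) : lang.BoundedFormula α n :=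
  Relations.boundedFormula (L := lang) Rel.orient ![t₁, t₂, t₃]

/-- The bound variable `x i`. -/
abbrev x {n : ℕ} (i : Fin n) : lang.Term (Empty ⊕ Fin n) := Term.var (Sum.inr i)

end Terms

/-! ### The axioms -/

/-- Abelian groups. -/
def groupAxioms : lang.Theory :=
  { ∀' ∀' ∀' (((x 0 + x 1) + x 2) =' (x 0 + (x 1 + x 2))),
    ∀' ∀' ((x 0 + x 1) =' (x 1 + x 0)),
    ∀' ((0 + x 0) =' x 0),
    ∀' ((-(x 0) + x 0) =' 0) }

/-- `O` is a cyclic relation invariant under translations, and `x <₀ y :↔ O(0, x, y)` is a strict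
linear order on the nonzero elements: irreflexive, relating nonzero elements only, transitive and
total. -/
def orientationAxioms : lang.Theory :=
  { ∀' ∀' ∀' (orient (x 0) (x 1) (x 2) ⟹ orient (x 1) (x 2) (x 0)),
    ∀' ∀' ∀' ∀' (orient (x 0) (x 1) (x 2) ⟹ orient (x 0 + x 3) (x 1 + x 3) (x 2 + x 3)),
    ∀' ∼(orient 0 (x 0) (x 0)),
    ∀' ∀' (orient 0 (x 0) (x 1) ⟹ (∼(x 0 =' 0) ⊓ ∼(x 1 =' 0))),
    ∀' ∀' ∀' (orient 0 (x 0) (x 1) ⟹ (orient 0 (x 1) (x 2) ⟹ orient 0 (x 0) (x 2))),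
    ∀' ∀' (∼(x 0 =' 0) ⟹ (∼(x 1 =' 0) ⟹ (∼(x 0 =' x 1) ⟹
      (orient 0 (x 0) (x 1) ⊔ orient 0 (x 1) (x 0))))) }

/-- Regular density at `p`: whenever `O(0, a, b)`, there is `c` with `O(a, p c, b)` and
`i c <₀ (i + 1) c` for `1 ≤ i ≤ p - 1`. -/
noncomputable def regularlyDense (p : ℕ) : lang.Sentence :=
  ∀' ∀' (orient 0 (x 0) (x 1) ⟹
    ∃' (orient (x 0) (p • x 2) (x 1) ⊓
      BoundedFormula.iInf fun i : Finset.Icc 1 (p - 1) =>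
        orient 0 ((i : ℕ) • x 2) (((i : ℕ) + 1) • x 2)))

/-- There are `n` elements that are pairwise incongruent modulo `p A`. -/
noncomputable def atLeastCosets (p n : ℕ) : lang.Sentence :=
  (BoundedFormula.iInf fun ij : {ij : Fin n × Fin n // ij.1 ≠ ij.2} =>
    (∼ (∃' ((x ij.1.1.castSucc + -(x ij.1.2.castSucc)) =' (p • x (Fin.last n)))) :
      lang.BoundedFormula Empty n)).exs

/-- `Tor_{p^(k+1)}(A) ⊆ Tor_{p^k}(A)`. -/
def torsionStable (p k : ℕ) : lang.Sentence :=
  ∀' ((((p ^ (k + 1)) • x 0) =' 0) ⟹ (((p ^ k) • x 0) =' 0))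

/-- `p ^ d` for `d ∈ ℕ ∪ {∞}`, with `p ^ ∞ = ∞`. -/
def primePow (p : ℕ) : ℕ∞ → ℕ∞
  | ⊤ => ⊤
  | (k : ℕ) => ((p ^ k : ℕ) : ℕ∞)

/-- The theory `T(d, e)` of the regularly dense oriented abelian groups `A` such that
`[p]A = |A / pA| = p ^ (d p)` and `e(A, p) = e p` for every prime `p`. The sequences `d` and `e`
are indexed by the primes. -/
def theory (d e : Nat.Primes → ℕ∞) : lang.Theory :=
  groupAxioms ∪ orientationAxioms ∪
  {σ | ∃ p : Nat.Primes, σ = regularlyDense p} ∪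
  {σ | ∃ (p : Nat.Primes) (n : ℕ), (n : ℕ∞) ≤ primePow p (d p) ∧ σ = atLeastCosets p n} ∪
  {σ | ∃ (p : Nat.Primes) (n : ℕ), primePow p (d p) < n ∧ σ = ∼(atLeastCosets p n)} ∪
  {σ | ∃ (p : Nat.Primes) (k : ℕ), e p ≤ k ∧ σ = torsionStable p k} ∪
  {σ | ∃ (p : Nat.Primes) (k : ℕ), (k : ℕ∞) < e p ∧ σ = ∼(torsionStable p k)}

/-! ### The models of the theory -/

/-- An oriented abelian group, as a structure in the language `L_O`. -/
@[reducible] def structureOf {A : Type*} [AddCommGroup A] (O : A → A → A → Prop) :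
    lang.Structure A where
  funMap
    | Func.zero, _ => 0
    | Func.neg, v => -v 0
    | Func.add, v => v 0 + v 1
  RelMap
    | Rel.orient, v => O (v 0) (v 1) (v 2)

/-- `O` is an orientation on the abelian group `A`. -/
structure IsOrientation {A : Type*} [AddCommGroup A] (O : A → A → A → Prop) : Prop where
  cyclic : ∀ a b c, O a b c → O b c a
  add_right : ∀ a b c d, O a b c → O (a + d) (b + d) (c + d)
  irrefl : ∀ a, ¬ O 0 a a
  ne_zero : ∀ a b, O 0 a b → a ≠ 0 ∧ b ≠ 0
  trans : ∀ a b c, O 0 a b → O 0 b c → O 0 a c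
  total : ∀ a b, a ≠ 0 → b ≠ 0 → a ≠ b → O 0 a b ∨ O 0 b a

/-- Regular density of an oriented abelian group. -/
def IsRegularlyDense {A : Type*} [AddCommGroup A] (O : A → A → A → Prop) : Prop :=
  ∀ p : ℕ, p.Prime → ∀ a b, O 0 a b →
    ∃ c, O a (p • c) b ∧ ∀ i ∈ Finset.Icc 1 (p - 1), O 0 (i • c) ((i + 1) • c)

/-- `e(A, p)`: the least `k` such that the chain of the `Tor_{p^k}(A) = {x | p^k x = 0}` is constant
from `k` on, and `∞` if there is none. -/
noncomputable def torsionExponent (A : Type*) [AddCommGroup A] (p : ℕ) : ℕ∞ :=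
  ⨅ (k : ℕ) (_ : ∀ m : ℕ, {x : A | p ^ (k + m) • x = 0} = {x : A | p ^ k • x = 0}), (k : ℕ∞)

section Models

variable {A : Type*} [AddCommGroup A] (O : A → A → A → Prop)

lemma realize_zero {α : Type*} (v : α → A) :
    @Term.realize lang A (structureOf O) α v 0 = 0 := rfl

lemma realize_neg {α : Type*} (v : α → A) (t : lang.Term α) :
    @Term.realize lang A (structureOf O) α v (-t) = -@Term.realize lang A (structureOf O) α v t :=
  rfl

lemma realize_add {α : Type*} (v : α → A) (t u : lang.Term α) :
    @Term.realize lang A (structureOf O) α v (t + u) =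
      @Term.realize lang A (structureOf O) α v t + @Term.realize lang A (structureOf O) α v u :=
  rfl

lemma realize_nsmul {α : Type*} (v : α → A) (k : ℕ) (t : lang.Term α) :
    @Term.realize lang A (structureOf O) α v (k • t) =
      k • @Term.realize lang A (structureOf O) α v t := by
  induction k with
  | zero => rw [zero_smul]; rfl
  | succ k ih => rw [succ_nsmul, ← ih]; rfl

lemma realize_orient {α : Type*} (v : α → A) {n : ℕ} (xs : Fin n → A) (t₁ t₂ t₃ : lang.Term (α ⊕ Fin n)) :
    @BoundedFormula.Realize lang A (structureOf O) α n (orient t₁ t₂ t₃) v xs ↔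
      O (@Term.realize lang A (structureOf O) _ (Sum.elim v xs) t₁)
        (@Term.realize lang A (structureOf O) _ (Sum.elim v xs) t₂)
        (@Term.realize lang A (structureOf O) _ (Sum.elim v xs) t₃) := Iff.rfl

lemma realize_regularlyDense (p : ℕ) :
    @Sentence.Realize lang A (structureOf O) (regularlyDense p) ↔
      ∀ a b, O 0 a b → ∃ c, O a (p • c) b ∧
        ∀ i ∈ Finset.Icc 1 (p - 1), O 0 (i • c) ((i + 1) • c) := by
  let _ := structureOf O
  simp only [regularlyDense, Sentence.Realize, Formula.Realize, BoundedFormula.realize_all,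
    BoundedFormula.realize_imp, BoundedFormula.realize_ex, BoundedFormula.realize_inf,
    BoundedFormula.realize_iInf, realize_orient, realize_nsmul, realize_zero]
  simp [Fin.snoc]

lemma realize_atLeastCosets (p n : ℕ) :
    @Sentence.Realize lang A (structureOf O) (atLeastCosets p n) ↔
      ∃ x : Fin n → A, ∀ i j, i ≠ j → ¬ ∃ z, x i - x j = p • z := by
  let _ := structureOf O
  simp only [atLeastCosets, Sentence.Realize, BoundedFormula.realize_exs,
    BoundedFormula.realize_iInf, BoundedFormula.realize_not, BoundedFormula.realize_ex,
    BoundedFormula.realize_bdEqual, realize_nsmul, realize_add, realize_neg]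
  simp [Fin.snoc, sub_eq_add_neg]

lemma realize_torsionStable (p k : ℕ) :
    @Sentence.Realize lang A (structureOf O) (torsionStable p k) ↔
      ∀ x : A, p ^ (k + 1) • x = 0 → p ^ k • x = 0 := by
  let _ := structureOf O
  simp only [torsionStable, Sentence.Realize, Formula.Realize, BoundedFormula.realize_all,
    BoundedFormula.realize_imp, BoundedFormula.realize_bdEqual, realize_nsmul, realize_zero]
  simp [Fin.snoc]

lemma model_groupAxioms : @Theory.Model lang A (structureOf O) groupAxioms := by
  let _ := structureOf O
  simp only [groupAxioms, Theory.model_insert_iff, Theory.model_singleton_iff, Sentence.Realize,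
    Formula.Realize, BoundedFormula.realize_all, BoundedFormula.realize_bdEqual, realize_add,
    realize_neg, realize_zero]
  refine ⟨fun a b c => add_assoc a b c, fun a b => add_comm a b, fun a => zero_add a,
    fun a => neg_add_cancel a⟩

lemma model_orientationAxioms :
    @Theory.Model lang A (structureOf O) orientationAxioms ↔ IsOrientation O := by
  let _ := structureOf O
  simp only [orientationAxioms, Theory.model_insert_iff, Theory.model_singleton_iff,
    Sentence.Realize, Formula.Realize, BoundedFormula.realize_all, BoundedFormula.realize_imp,
    BoundedFormula.realize_not, BoundedFormula.realize_inf, BoundedFormula.realize_sup,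
    BoundedFormula.realize_bdEqual, realize_orient, realize_add, realize_zero]
  constructor
  · rintro ⟨h1, h2, h3, h4, h5, h6⟩
    exact ⟨h1, h2, h3, h4, h5, h6⟩
  · rintro ⟨h1, h2, h3, h4, h5, h6⟩
    exact ⟨h1, h2, h3, h4, h5, h6⟩

lemma torsionStable_iff (p k : ℕ) :
    (∀ x : A, p ^ (k + 1) • x = 0 → p ^ k • x = 0) ↔ torsionExponent A p ≤ k := by
  have step : ∀ j, (∀ x : A, p ^ (j + 1) • x = 0 → p ^ j • x = 0) →
      ∀ m : ℕ, {x : A | p ^ (j + m) • x = 0} = {x : A | p ^ j • x = 0} := by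
    intro j hj m
    induction m with
    | zero => rfl
    | succ m ih =>
      rw [← ih]
      ext x
      simp only [Set.mem_ofPred_eq]
      constructor
      · intro h
        have h' : p ^ (j + 1) • p ^ m • x = 0 := by
          rw [← h, ← mul_smul]
          congr 1
          ring
        rw [pow_add, mul_smul]
        exact hj _ h'
      · intro h
        rw [← add_assoc, pow_succ', mul_smul, h, smul_zero]
  constructor
  · intro h
    exact iInf₂_le k (step k h)
  · intro h x hx
    have hne : ∃ j : ℕ, (∀ m : ℕ, {x : A | p ^ (j + m) • x = 0} = {x : A | p ^ j • x = 0}) ∧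
        j ≤ k := by
      by_contra! hcon
      have : ((k + 1 : ℕ) : ℕ∞) ≤ torsionExponent A p :=
        le_iInf₂ fun j hj => by exact_mod_cast hcon j hj
      have := this.trans h
      norm_cast at this
      omega
    obtain ⟨j, hj, hjk⟩ := hne
    obtain ⟨m, rfl⟩ := Nat.exists_eq_add_of_le hjk
    have h1 : x ∈ {x : A | p ^ (j + (m + 1)) • x = 0} := by rw [← add_assoc]; exact hx
    rw [hj] at h1
    have h2 : x ∈ {x : A | p ^ (j + m) • x = 0} := by rw [hj]; exact h1
    exact h2

lemma atLeastCosets_iff (p n : ℕ) :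
    (∃ x : Fin n → A, ∀ i j, i ≠ j → ¬ ∃ z, x i - x j = p • z) ↔
      (n : ℕ∞) ≤ ENat.card (A ⧸ (nsmulAddMonoidHom (α := A) p).range) := by
  have key : ∀ a b : A, (a : A ⧸ (nsmulAddMonoidHom (α := A) p).range) = b ↔
      ∃ z, b - a = p • z := by
    intro a b
    rw [QuotientAddGroup.eq, AddMonoidHom.mem_range]
    simp only [nsmulAddMonoidHom_apply, neg_add_eq_sub, eq_comm]
  have h1 : (n : ℕ∞) ≤ ENat.card (A ⧸ (nsmulAddMonoidHom (α := A) p).range) ↔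
      Nonempty (Fin n ↪ A ⧸ (nsmulAddMonoidHom (α := A) p).range) := by
    rw [← Cardinal.lift_mk_le', Cardinal.mk_fin, Cardinal.lift_natCast, Cardinal.nat_le_lift_iff,
      ENat.card, Cardinal.natCast_le_toENat]
  rw [h1]
  constructor
  · rintro ⟨x, hx⟩
    refine ⟨⟨fun i => (x i : A ⧸ (nsmulAddMonoidHom (α := A) p).range), fun i j hij => ?_⟩⟩
    by_contra hne
    exact hx j i (Ne.symm hne) ((key _ _).1 hij)
  · rintro ⟨f⟩
    refine ⟨fun i => (f i).out, fun i j hij hz => hij ?_⟩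
    have := (key _ _).2 hz
    rw [QuotientAddGroup.out_eq', QuotientAddGroup.out_eq'] at this
    exact (f.injective this).symm

lemma eq_iff_forall_le {a b : ℕ∞} :
    a = b ↔ (∀ n : ℕ, (n : ℕ∞) ≤ b → (n : ℕ∞) ≤ a) ∧ ∀ n : ℕ, b < (n : ℕ∞) → ¬ (n : ℕ∞) ≤ a := by
  constructor
  · rintro rfl
    exact ⟨fun _ h => h, fun _ h => not_le.2 h⟩
  · rintro ⟨h1, h2⟩
    exact le_antisymm
      (ENat.forall_natCast_le_iff_le.1 fun n hn => by by_contra h; exact h2 n (not_le.1 h) hn)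
      (ENat.forall_natCast_le_iff_le.1 h1)

/-- The models of `T(d, e)`. -/
theorem model_theory_iff (d e : Nat.Primes → ℕ∞) :
    @Theory.Model lang A (structureOf O) (theory d e) ↔
      IsOrientation O ∧ IsRegularlyDense O ∧
      (∀ p : Nat.Primes, ENat.card (A ⧸ (nsmulAddMonoidHom (α := A) (p : ℕ)).range) =
        primePow p (d p)) ∧
      ∀ p : Nat.Primes, torsionExponent A p = e p := by
  let _ := structureOf O
  have hd : ∀ p : Nat.Primes, ∀ n : ℕ, A ⊨ atLeastCosets p n ↔
      (n : ℕ∞) ≤ ENat.card (A ⧸ (nsmulAddMonoidHom (α := A) (p : ℕ)).range) := fun p n =>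
    (realize_atLeastCosets O p n).trans (atLeastCosets_iff p n)
  have he : ∀ p : Nat.Primes, ∀ k : ℕ, A ⊨ torsionStable p k ↔ torsionExponent A p ≤ k :=
    fun p k => (realize_torsionStable O p k).trans (torsionStable_iff p k)
  have hr : A ⊨ {σ : lang.Sentence | ∃ p : Nat.Primes, σ = regularlyDense p} ↔
      IsRegularlyDense O := by
    rw [Theory.model_iff]
    constructor
    · intro h p hp
      exact (realize_regularlyDense O p).1 (h _ ⟨⟨p, hp⟩, rfl⟩)
    · rintro h _ ⟨p, rfl⟩
      exact (realize_regularlyDense O p).2 (h p p.2)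
  simp only [theory, Theory.model_union_iff, hr, model_orientationAxioms, model_groupAxioms,
    true_and, and_assoc]
  refine and_congr_right fun _ => and_congr_right fun _ => ?_
  rw [← and_assoc]
  refine and_congr ?_ ?_
  · simp only [Theory.model_iff, eq_iff_forall_le, ← hd, forall_and]
    refine and_congr ⟨fun h p n hn => h _ ⟨p, n, hn, rfl⟩, ?_⟩
      ⟨fun h p n hn => (h _ ⟨p, n, hn, rfl⟩ : A ⊨ ∼(atLeastCosets p n)), ?_⟩
    · rintro h _ ⟨p, n, hn, rfl⟩
      exact h p n hn
    · rintro h _ ⟨p, n, hn, rfl⟩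
      exact h p n hn
  · simp only [Theory.model_iff]
    constructor
    · rintro ⟨h1, h2⟩ p
      have h3 : ∀ k : ℕ, e p ≤ k → torsionExponent A p ≤ k := fun k hk =>
        (he p k).1 (h1 _ ⟨p, k, hk, rfl⟩)
      have h4 : ∀ k : ℕ, torsionExponent A p ≤ k → e p ≤ k := fun k hk => by
        by_contra hc
        exact (h2 _ ⟨p, k, not_le.1 hc, rfl⟩ : A ⊨ ∼(torsionStable p k)) ((he p k).2 hk)
      refine le_antisymm ?_ ?_
      · cases hk : e p with
        | top => exact le_top
        | coe k => exact h3 k hk.le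
      · cases hk : torsionExponent A p with
        | top => exact le_top
        | coe k => exact h4 k hk.le
    · intro h
      constructor
      · rintro _ ⟨p, k, hk, rfl⟩
        exact (he p k).2 ((h p).le.trans hk)
      · rintro _ ⟨p, k, hk, rfl⟩
        exact fun hc => absurd ((h p).symm.le.trans ((he p k).1 hc)) (not_le.2 hk)

/-- Every model of the group axioms comes from an abelian group and a ternary relation. -/
theorem exists_eq_structureOf {M : Type*} [s : lang.Structure M] (h : M ⊨ groupAxioms) :
    ∃ (_ : AddCommGroup M) (O : M → M → M → Prop), s = structureOf O := by
  simp only [groupAxioms, Theory.model_insert_iff, Theory.model_singleton_iff] at h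
  obtain ⟨h1, h2, h3, h4⟩ := h
  let _ : Zero M := ⟨s.funMap (Func.zero : lang.Functions 0) ![]⟩
  let _ : Neg M := ⟨fun a => s.funMap (Func.neg : lang.Functions 1) ![a]⟩
  let _ : Add M := ⟨fun a b => s.funMap (Func.add : lang.Functions 2) ![a, b]⟩
  have e0 : ∀ xs : Fin 0 → M, s.funMap (Func.zero : lang.Functions 0) xs = 0 := fun xs =>
    congrArg _ (Subsingleton.elim _ _)
  have e1 : ∀ xs : Fin 1 → M, s.funMap (Func.neg : lang.Functions 1) xs = -xs 0 := fun xs =>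
    congrArg _ (by ext i; fin_cases i; rfl)
  have e2 : ∀ xs : Fin 2 → M, s.funMap (Func.add : lang.Functions 2) xs = xs 0 + xs 1 := fun xs =>
    congrArg _ (by ext i; fin_cases i <;> rfl)
  have r0 : ∀ (n : ℕ) (v : Empty ⊕ Fin n → M), (0 : lang.Term _).realize v = 0 := fun _ _ => e0 _
  have r1 : ∀ (n : ℕ) (v : Empty ⊕ Fin n → M) (t : lang.Term _),
    (-t).realize v = -t.realize v := fun _ _ _ => e1 _
  have r2 : ∀ (n : ℕ) (v : Empty ⊕ Fin n → M) (t u : lang.Term _),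
    (t + u).realize v = t.realize v + u.realize v := fun _ _ _ _ => e2 _
  simp only [Sentence.Realize, Formula.Realize, BoundedFormula.realize_all,
    BoundedFormula.realize_bdEqual, r0, r1, r2] at h1 h2 h3 h4
  have h3' : ∀ a : M, 0 + a = a := h3
  have h2' : ∀ a b : M, a + b = b + a := h2
  let g : AddCommGroup M :=
    { add_assoc := h1
      zero_add := h3'
      add_zero := fun a => (h2' a 0).trans (h3' a)
      nsmul := nsmulRec
      zsmul := zsmulRec
      neg_add_cancel := h4
      add_comm := h2' }
  refine ⟨g, fun a b c => s.RelMap (Rel.orient : lang.Relations 3) ![a, b, c], ?_⟩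
  apply Structure.ext
  · funext n f xs
    cases f with
    | zero => exact e0 xs
    | neg => exact e1 xs
    | add => exact e2 xs
  · funext n r xs
    cases r with
    | orient => exact congrArg _ (by ext i; fin_cases i <;> rfl)

end Models

end OrientedGroup

/-! Unwind the circle. An oriented group A is U/ℤz, where U is the extension of A by ℤ whose cocycle
records whether a sum passes 0, ordered lexicographically, and z is one full turn
(`Unwinding.isUnwinding`). If A is nontrivial, divisible and regularly dense, then nU is dense in U
for every n ≥ 1 (`IsUnwinding.exists_nsmul_mem_Ioo`). U itself need not be divisible, since z need
not be.

Definable relations on A are read on the cube [0, z)^ι. After the coordinates are multiplied by a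
suitable D > 0, they depend only on the signs of finitely many affine functions with integer
coefficients (`IsPiecewiseAffine.of_boundedFormula`). The scaling loses nothing, because every
element of A is π(Du) with u in [0, z). The quantifier step (`IsPiecewiseAffine.forall_option`)
turns the conditions on the quantified v into the position of Kv among thresholds that are affine in
the other variables. Density of KU transfers a position strictly between thresholds. An equality of
Kv with a threshold also needs solvability modulo K; scaling the other variables by K makes
corresponding thresholds congruent modulo K, so no congruence conditions arise.

For fixed parameters, an affine function of one variable is monotone or antitone. If c functions
suffice for the two formulas, an N × N piece of an ICT-pattern gives N² points of U separated by the
signs of cN such functions. These separate at most 2cN + 1 points (`card_le_of_sign_separated`), too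
few for N = 2c + 2. -/

namespace OrientedGroup

/-! ### The circle cut at 0: linear order and carry cocycle. -/

namespace IsOrientation

variable {A : Type*} [AddCommGroup A] {O : A → A → A → Prop}

/-- The strict linear order with least element `0` that extends `x <₀ y`. -/
def lt (_ : IsOrientation O) (a b : A) : Prop := (a = 0 ∧ b ≠ 0) ∨ O 0 a b

variable (h : IsOrientation O)
include h

lemma translate_iff (a b c d : A) : O (a + d) (b + d) (c + d) ↔ O a b c := by
  refine ⟨fun H => ?_, h.add_right a b c d⟩
  simpa using h.add_right _ _ _ (-d) H

lemma zero_sub_iff (a b c : A) : O 0 (b - a) (c - a) ↔ O a b c := by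
  simpa using (h.translate_iff 0 (b - a) (c - a) a).symm

lemma trans' {a b c d : A} (h1 : O a b c) (h2 : O a c d) : O a b d := by
  rw [← h.zero_sub_iff] at *
  exact h.trans _ _ _ h1 h2

lemma asymm' {a b c : A} (h1 : O a b c) : ¬ O a c b := by
  intro h2
  have := h.trans' h1 h2
  rw [← h.zero_sub_iff] at this
  exact h.irrefl _ this

lemma lt_irrefl (a : A) : ¬ h.lt a a := by
  rintro (⟨h1, h2⟩ | h1)
  · exact h2 h1
  · exact h.irrefl _ h1

lemma lt_trans {a b c : A} (h1 : h.lt a b) (h2 : h.lt b c) : h.lt a c := by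
  rcases h1 with ⟨h1, h1'⟩ | h1 <;> rcases h2 with ⟨h2, h2'⟩ | h2
  · exact absurd h2 h1'
  · exact Or.inl ⟨h1, (h.ne_zero _ _ h2).2⟩
  · exact absurd h2 (h.ne_zero _ _ h1).2
  · exact Or.inr (h.trans _ _ _ h1 h2)

lemma lt_trichotomy (a b : A) : h.lt a b ∨ a = b ∨ h.lt b a := by
  by_cases ha : a = 0
  · by_cases hb : b = 0
    · exact Or.inr (Or.inl (ha.trans hb.symm))
    · exact Or.inl (Or.inl ⟨ha, hb⟩)
  · by_cases hb : b = 0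
    · exact Or.inr (Or.inr (Or.inl ⟨hb, ha⟩))
    · by_cases hab : a = b
      · exact Or.inr (Or.inl hab)
      · rcases h.total a b ha hb hab with H | H
        · exact Or.inl (Or.inr H)
        · exact Or.inr (Or.inr (Or.inr H))

lemma of_lt_lt {a b c : A} (h1 : h.lt a b) (h2 : h.lt b c) : O a b c := by
  rcases h2 with ⟨h2, h2'⟩ | h2
  · subst h2
    rcases h1 with ⟨h1, h1'⟩ | h1
    · exact absurd rfl h1'
    · exact absurd rfl (h.ne_zero _ _ h1).2
  · rcases h1 with ⟨rfl, h1'⟩ | h1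
    · exact h2
    · have e1 : O b 0 a := h.cyclic _ _ _ (h.cyclic _ _ _ h1)
      have e2 : O b c 0 := h.cyclic _ _ _ h2
      exact h.cyclic _ _ _ (h.cyclic _ _ _ (h.trans' e2 e1))

/-- The three points are distinct, and any linear arrangement of the other cyclic type would give `O
a c b`, which `asymm'` excludes. So the cyclic order is determined by the linear order cut at 0. -/
lemma orient_iff (a b c : A) :
    O a b c ↔ (h.lt a b ∧ h.lt b c) ∨ (h.lt b c ∧ h.lt c a) ∨ (h.lt c a ∧ h.lt a b) := by
  constructor
  · intro H
    have hn := (h.zero_sub_iff a b c).2 H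
    have hab : a ≠ b := fun e => (h.ne_zero _ _ hn).1 (by simp [e])
    have hac : a ≠ c := fun e => (h.ne_zero _ _ hn).2 (by simp [e])
    have hbc : b ≠ c := by rintro rfl; exact h.irrefl _ hn
    have hna := h.asymm' H
    have t := h.lt_trichotomy
    have t1 := fun {x y z : A} => h.lt_trans (a := x) (b := y) (c := z)
    have o1 := fun h1 h2 => hna (h.of_lt_lt (a := a) (b := c) (c := b) h1 h2)
    have o2 := fun h1 h2 => hna (h.cyclic _ _ _ (h.of_lt_lt (a := b) (b := a) (c := c) h1 h2))
    have o3 := fun h1 h2 =>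
      hna (h.cyclic _ _ _ (h.cyclic _ _ _ (h.of_lt_lt (a := c) (b := b) (c := a) h1 h2)))
    rcases t a b with e1 | e1 | e1 <;> rcases t b c with e2 | e2 | e2 <;>
      rcases t a c with e3 | e3 | e3 <;> tauto
  · rintro (⟨h1, h2⟩ | ⟨h1, h2⟩ | ⟨h1, h2⟩)
    · exact h.of_lt_lt h1 h2
    · exact h.cyclic _ _ _ (h.cyclic _ _ _ (h.of_lt_lt h1 h2))
    · exact h.cyclic _ _ _ (h.of_lt_lt h1 h2)

lemma lt_iff_add_right (d a b : A) :
    h.lt a b ↔ (a + d = d ∧ b + d ≠ d) ∨ (h.lt d (a + d) ∧ h.lt (a + d) (b + d)) ∨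
      (h.lt (a + d) (b + d) ∧ h.lt (b + d) d) ∨ (h.lt (b + d) d ∧ h.lt d (a + d)) := by
  rw [← h.orient_iff, lt]
  have := h.translate_iff 0 a b d
  rw [zero_add] at this
  rw [this]
  simp

lemma not_lt_zero (a : A) : ¬ h.lt a 0 := by
  rintro (⟨-, h2⟩ | h2)
  · exact h2 rfl
  · exact (h.ne_zero _ _ h2).2 rfl

open Classical in
/-- The number of times that `a + b` winds around the circle: `1` if it passes `0`, else `0`. -/
noncomputable def carry (a b : A) : ℤ := if h.lt (a + b) a then 1 else 0

lemma carry_cases (a b : A) :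
    (h.lt (a + b) a ∧ h.carry a b = 1) ∨ (¬ h.lt (a + b) a ∧ h.carry a b = 0) := by
  by_cases H : h.lt (a + b) a
  · exact Or.inl ⟨H, if_pos H⟩
  · exact Or.inr ⟨H, if_neg H⟩

lemma orient_neg {a b : A} (H : O 0 a b) : O 0 (-b) (-a) := by
  have hne := h.ne_zero _ _ H
  have hab : a ≠ b := by rintro rfl; exact h.irrefl _ H
  rcases h.total (-b) (-a) (by simpa using hne.2) (by simpa using hne.1)
    (by simpa using hab.symm) with H' | H'
  · exact H'
  · exfalso
    have h1 : O 0 (b - a) (-a) := by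
      have := h.cyclic _ _ _ (h.add_right _ _ _ (-a) H)
      simpa [sub_eq_add_neg] using this
    have h2 : O 0 (-b) (a - b) := by
      have := h.cyclic _ _ _ (h.cyclic _ _ _ (h.add_right _ _ _ (-b) H))
      simpa [sub_eq_add_neg] using this
    have h3 : O 0 (a - b) a := by
      have := h.cyclic _ _ _ (h.add_right _ _ _ a H')
      simpa [sub_eq_add_neg, add_comm] using this
    have h4 : O 0 b (b - a) := by
      have := h.cyclic _ _ _ (h.cyclic _ _ _ (h.add_right _ _ _ b H'))
      simpa [sub_eq_add_neg, add_comm] using this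
    have t := fun {x y z : A} => h.trans x y z
    -- The cycle a < b < b - a < -a < -b < a - b < a.
    exact h.irrefl _ (t (t (t (t (t H h4) h1) H') h2) h3)

lemma lt_add_self_comm {a b : A} (H : h.lt (a + b) a) : h.lt (a + b) b := by
  rcases H with ⟨h1, h2⟩ | H
  · refine Or.inl ⟨h1, ?_⟩
    rintro rfl
    exact h2 (by simpa using h1)
  · right
    have h1 : O 0 (-a) b := by
      have := h.cyclic _ _ _ (h.cyclic _ _ _ (h.add_right _ _ _ (-a) H))
      simpa using this
    have h2 := h.cyclic _ _ _ (h.add_right _ _ _ b (h.orient_neg h1))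
    simpa using h2

lemma carry_comm (a b : A) : h.carry a b = h.carry b a := by
  have h1 := @lt_add_self_comm _ _ _ h a b
  have h2 := @lt_add_self_comm _ _ _ h b a
  rw [add_comm b a] at h2
  have h3 := h.carry_cases b a
  rw [add_comm b a] at h3
  have h4 := h.carry_cases a b
  grind

/-- Translation by a turns the criterion for b + c to wrap into a statement about the places of a, a
+ b and a + b + c in the linear order. Each possible arrangement gives the same number of wraps for
both bracketings. -/
lemma carry_assoc (a b c : A) :
    h.carry a b + h.carry (a + b) c = h.carry b c + h.carry a (b + c) := by
  have h1 := h.lt_iff_add_right a (b + c) b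
  have h2 := h.carry_cases a b
  have h3 := h.carry_cases (a + b) c
  have h4 := h.carry_cases b c
  have h5 := h.carry_cases a (b + c)
  rw [show b + c + a = a + (b + c) by abel, show b + a = a + b by abel] at h1
  rw [show a + b + c = a + (b + c) by abel] at h3
  generalize a + (b + c) = z at *
  generalize a + b = y at *
  generalize h.lt (b + c) b = p at *
  have ia := h.lt_irrefl a
  have iy := h.lt_irrefl y
  have iz := h.lt_irrefl z
  have t1 := fun h1 h2 => ia (h.lt_trans (b := y) h1 h2)
  have t2 := fun h1 h2 => ia (h.lt_trans (b := z) h1 h2)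
  have t3 := fun h1 h2 => iy (h.lt_trans (b := z) h1 h2)
  have t4 := fun h1 h2 h3 => ia (h.lt_trans (b := y) h1 (h.lt_trans (b := z) h2 h3))
  have t5 := fun h1 h2 h3 => ia (h.lt_trans (b := z) h1 (h.lt_trans (b := y) h2 h3))
  have ta := h.lt_trichotomy a y
  have tb := h.lt_trichotomy y z
  have tc := h.lt_trichotomy a z
  have key : h.lt z y ↔ ¬ h.lt y z ∧ y ≠ z := by grind
  rcases h2 with ⟨p2, h2⟩ | ⟨p2, h2⟩ <;> rcases h3 with ⟨p3, h3⟩ | ⟨p3, h3⟩ <;>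
    rcases h4 with ⟨p4, h4⟩ | ⟨p4, h4⟩ <;> rcases h5 with ⟨p5, h5⟩ | ⟨p5, h5⟩ <;>
    rw [h2, h3, h4, h5] <;> norm_num <;> clear h2 h3 h4 h5 <;> grind

/-- Translation respects the lexicographic order of carry and residue. If only b wraps, b + d lands
before a + d; this matters when a lead in the integer coordinate of `Unwinding` is cancelled by a
carry. -/
lemma carry_mono {a b d : A} (H : h.lt a b) :
    h.carry a d < h.carry b d ∧ h.lt (b + d) (a + d) ∨
      h.carry a d = h.carry b d ∧ h.lt (a + d) (b + d) := by
  have h1 := (h.lt_iff_add_right d a b).1 H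
  rw [h.carry_comm a, h.carry_comm b]
  have h2 := h.carry_cases d a
  have h3 := h.carry_cases d b
  rw [add_comm d] at h2 h3
  generalize a + d = x at *
  generalize b + d = y at *
  have id := h.lt_irrefl d
  have t1 := fun h1 h2 => id (h.lt_trans (b := x) h1 h2)
  have t2 := fun h1 h2 => id (h.lt_trans (b := y) h1 h2)
  have t3 := fun h1 h2 => h.lt_trans (a := d) (b := x) (c := y) h1 h2
  have t4 := fun h1 h2 => h.lt_trans (a := x) (b := y) (c := d) h1 h2
  have t5 := fun h1 h2 => h.lt_trans (a := y) (b := d) (c := x) h1 h2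
  have tc := h.lt_trichotomy d y
  rcases h2 with ⟨p2, h2⟩ | ⟨p2, h2⟩ <;> rcases h3 with ⟨p3, h3⟩ | ⟨p3, h3⟩ <;>
    rw [h2, h3] <;> norm_num <;> clear h2 h3 <;> grind

lemma carry_zero (a : A) : h.carry a 0 = 0 := by
  have := h.carry_cases a 0
  have := h.lt_irrefl a
  grind

lemma carry_nonneg (a b : A) : 0 ≤ h.carry a b := by
  have := h.carry_cases a b
  grind

lemma carry_le_one (a b : A) : h.carry a b ≤ 1 := by
  have := h.carry_cases a b
  grind

end IsOrientation

/-! ### Unwinding an orientation to a linear order -/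

/-- The linearly ordered abelian group that an oriented abelian group `A` is a quotient of: the
extension of `A` by `ℤ` with the cocycle `carry`, ordered lexicographically. -/
@[ext]
structure Unwinding {A : Type*} [AddCommGroup A] {O : A → A → A → Prop} (_ : IsOrientation O) where
  fst : ℤ
  snd : A

namespace Unwinding

variable {A : Type*} [AddCommGroup A] {O : A → A → A → Prop} {h : IsOrientation O}

noncomputable instance : Add (Unwinding h) := ⟨fun u v => ⟨u.1 + v.1 + h.carry u.2 v.2, u.2 + v.2⟩⟩

instance : Zero (Unwinding h) := ⟨⟨0, 0⟩⟩

noncomputable instance : Neg (Unwinding h) := ⟨fun u => ⟨-u.1 - h.carry u.2 (-u.2), -u.2⟩⟩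

noncomputable instance : AddCommGroup (Unwinding h) where
  add_assoc u v w := by
    refine Unwinding.ext ?_ (add_assoc u.2 v.2 w.2)
    change u.1 + v.1 + h.carry u.2 v.2 + w.1 + h.carry (u.2 + v.2) w.2 =
      u.1 + (v.1 + w.1 + h.carry v.2 w.2) + h.carry u.2 (v.2 + w.2)
    linarith [h.carry_assoc u.2 v.2 w.2]
  zero_add u := by
    refine Unwinding.ext ?_ (zero_add u.2)
    change 0 + u.1 + h.carry 0 u.2 = u.1
    rw [h.carry_comm, h.carry_zero]
    ring
  add_zero u := by
    refine Unwinding.ext ?_ (add_zero u.2)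
    change u.1 + 0 + h.carry u.2 0 = u.1
    rw [h.carry_zero]
    ring
  nsmul := nsmulRec
  zsmul := zsmulRec
  neg_add_cancel u := by
    refine Unwinding.ext ?_ (neg_add_cancel u.2)
    change -u.1 - h.carry u.2 (-u.2) + u.1 + h.carry (-u.2) u.2 = 0
    rw [h.carry_comm (-u.2)]
    ring
  add_comm u v := by
    refine Unwinding.ext ?_ (add_comm u.2 v.2)
    change u.1 + v.1 + h.carry u.2 v.2 = v.1 + u.1 + h.carry v.2 u.2
    rw [h.carry_comm, add_comm u.1]

lemma add_fst (u v : Unwinding h) : (u + v).1 = u.1 + v.1 + h.carry u.2 v.2 := rfl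
lemma add_snd (u v : Unwinding h) : (u + v).2 = u.2 + v.2 := rfl

open Classical in
noncomputable instance : LinearOrder (Unwinding h) where
  le u v := u = v ∨ (u.1 < v.1 ∨ u.1 = v.1 ∧ h.lt u.2 v.2)
  lt u v := u.1 < v.1 ∨ u.1 = v.1 ∧ h.lt u.2 v.2
  le_refl u := Or.inl rfl
  le_trans u v w := by
    rintro (rfl | h1) (rfl | h2)
    · exact Or.inl rfl
    · exact Or.inr h2
    · exact Or.inr h1
    · have := h.lt_trans (a := u.2) (b := v.2) (c := w.2)
      right
      grind
  lt_iff_le_not_ge u v := by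
    have h1 := h.lt_irrefl u.2
    have h2 := fun e1 e2 => h1 (h.lt_trans (b := v.2) e1 e2)
    grind
  le_antisymm u v := by
    rintro (rfl | h1) (h2 | h2)
    · rfl
    · rfl
    · exact h2.symm
    · exfalso
      have h1 := h.lt_irrefl u.2
      have h2 := fun e1 e2 => h1 (h.lt_trans (b := v.2) e1 e2)
      grind
  le_total u v := by
    have h1 := h.lt_trichotomy u.2 v.2
    have h2 : u.1 = v.1 → u.2 = v.2 → u = v := Unwinding.ext
    grind
  toDecidableLE := inferInstance

lemma lt_def (u v : Unwinding h) : u < v ↔ u.1 < v.1 ∨ u.1 = v.1 ∧ h.lt u.2 v.2 := Iff.rfl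

instance : IsOrderedAddMonoid (Unwinding h) where
  add_le_add_left u v huv w := by
    rcases huv.eq_or_lt with rfl | huv
    · exact le_rfl
    · refine le_of_lt ?_
      rw [lt_def] at huv ⊢
      rw [add_fst, add_fst, add_snd, add_snd]
      have h1 := h.carry_nonneg v.2 w.2
      have h2 := h.carry_le_one u.2 w.2
      rcases huv with huv | ⟨e, huv⟩
      · rcases h.lt_trichotomy u.2 v.2 with H | H | H
        · have := h.carry_mono (d := w.2) H
          grind
        · rw [H]
          grind
        · have := h.carry_mono (d := w.2) H
          grind
      · have := h.carry_mono (d := w.2) huv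
        grind

/-- The projection to `A`. -/
def proj (h : IsOrientation O) : Unwinding h →+ A where
  toFun u := u.2
  map_zero' := rfl
  map_add' _ _ := rfl

/-- The generator of the kernel of the projection. -/
def turn (h : IsOrientation O) : Unwinding h := ⟨1, 0⟩

lemma nsmul_turn (n : ℕ) : n • turn h = ⟨n, 0⟩ := by
  induction n with
  | zero => rw [zero_smul]; rfl
  | succ n ih =>
    rw [succ_nsmul, ih]
    refine Unwinding.ext ?_ (add_zero (0 : A))
    change (n : ℤ) + 1 + h.carry 0 0 = ((n + 1 : ℕ) : ℤ)
    rw [h.carry_zero]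
    push_cast
    ring

lemma zsmul_turn (n : ℤ) : n • turn h = ⟨n, 0⟩ := by
  obtain ⟨k, rfl | rfl⟩ := n.eq_nat_or_neg
  · rw [natCast_zsmul, nsmul_turn]
  · rw [neg_smul, natCast_zsmul, nsmul_turn]
    refine Unwinding.ext ?_ neg_zero
    change -(k : ℤ) - h.carry 0 (-0) = -k
    rw [neg_zero, h.carry_zero, sub_zero]

lemma sub_zsmul_turn (u : Unwinding h) (n : ℤ) : u - n • turn h = ⟨u.1 - n, u.2⟩ := by
  rw [sub_eq_add_neg, ← neg_smul, zsmul_turn]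
  refine Unwinding.ext ?_ (add_zero u.2)
  change u.1 + -n + h.carry u.2 0 = u.1 - n
  rw [h.carry_zero, add_zero, sub_eq_add_neg]

lemma pos_iff (n : ℤ) (a : A) : (0 : Unwinding h) < ⟨n, a⟩ ↔ 0 < n ∨ 0 = n ∧ a ≠ 0 := by
  rw [lt_def]
  change 0 < n ∨ 0 = n ∧ h.lt 0 a ↔ _
  refine or_congr_right (and_congr_right fun _ => ?_)
  rw [IsOrientation.lt]
  have := h.ne_zero 0 a
  tauto

lemma lt_turn_iff (n : ℤ) (a : A) : (⟨n, a⟩ : Unwinding h) < turn h ↔ n < 1 := by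
  rw [lt_def]
  change n < 1 ∨ n = 1 ∧ h.lt a 0 ↔ _
  have := h.not_lt_zero a
  tauto

end Unwinding

/-- An oriented abelian group is the quotient of a linearly ordered abelian group by the subgroup
generated by a positive element `z`, with the orientation induced by the order on `[0, z)`. -/
structure IsUnwinding {A U : Type*} [AddCommGroup A] [AddCommGroup U] [LinearOrder U]
    (O : A → A → A → Prop) (z : U) (π : U →+ A) : Prop where
  pos : 0 < z
  surj : ∀ a, ∃ u, 0 ≤ u ∧ u < z ∧ π u = a
  ker : ∀ u, π u = 0 ↔ ∃ m : ℤ, u = m • z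
  orient : ∀ u v, O 0 (π u) (π v) ↔
    ∃ m n : ℤ, 0 < u - m • z ∧ u - m • z < v - n • z ∧ v - n • z < z

theorem Unwinding.isUnwinding {A : Type*} [AddCommGroup A] {O : A → A → A → Prop}
    (h : IsOrientation O) : IsUnwinding O (Unwinding.turn h) (Unwinding.proj h) where
  pos := (pos_iff 1 0).2 (Or.inl one_pos)
  surj a := by
    refine ⟨⟨0, a⟩, ?_, (lt_turn_iff 0 a).2 one_pos, rfl⟩
    by_cases ha : a = 0
    · rw [ha]; exact le_refl (0 : Unwinding h)
    · exact ((pos_iff 0 a).2 (Or.inr ⟨rfl, ha⟩)).le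
  ker u := by
    constructor
    · intro hu
      exact ⟨u.1, by rw [zsmul_turn]; exact Unwinding.ext rfl hu⟩
    · rintro ⟨m, rfl⟩
      rw [zsmul_turn]
      rfl
  orient u v := by
    simp only [sub_zsmul_turn, pos_iff, lt_turn_iff]
    change O 0 u.2 v.2 ↔ _
    constructor
    · intro H
      refine ⟨u.1, v.1, Or.inr ⟨(sub_self _).symm, (h.ne_zero _ _ H).1⟩, ?_, by simp⟩
      rw [lt_def]
      exact Or.inr ⟨by simp, Or.inr H⟩
    · rintro ⟨m, n, h1, h2, h3⟩
      rw [lt_def] at h2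
      change u.1 - m < v.1 - n ∨ u.1 - m = v.1 - n ∧ h.lt u.2 v.2 at h2
      -- Both representatives lie between 0 and the turn, so both have integer coordinate 0.
      have h4 : h.lt u.2 v.2 ∧ u.2 ≠ 0 := by grind
      exact h4.1.resolve_left fun h5 => h4.2 h5.1

end OrientedGroup

/-! ### Density of the multiples nU in U. -/

namespace OrientedGroup

namespace IsUnwinding

variable {A U : Type*} [AddCommGroup A] [AddCommGroup U] [LinearOrder U]
  {O : A → A → A → Prop} {z : U} {π : U →+ A}

lemma map_turn (h : IsUnwinding O z π) : π z = 0 := (h.ker z).2 ⟨1, (one_smul _ _).symm⟩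

lemma map_zsmul_turn (h : IsUnwinding O z π) (m : ℤ) : π (m • z) = 0 := (h.ker _).2 ⟨m, rfl⟩

lemma exists_reduce (h : IsUnwinding O z π) (u : U) : ∃ m : ℤ, 0 ≤ u - m • z ∧ u - m • z < z := by
  obtain ⟨v, hv0, hvz, hv⟩ := h.surj (π u)
  obtain ⟨m, hm⟩ := (h.ker (u - v)).1 (by rw [map_sub, hv, sub_self])
  exact ⟨m, by rw [← hm, sub_sub_cancel]; exact ⟨hv0, hvz⟩⟩

/-- Divisibility of `A` in terms of `U`. -/
lemma exists_eq_nsmul_add (h : IsUnwinding O z π) {n : ℕ} (hdiv : ∀ a : A, ∃ b, a = n • b) (u : U) :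
    ∃ (w : U) (m : ℤ), u = n • w + m • z := by
  obtain ⟨b, hb⟩ := hdiv (π u)
  obtain ⟨w, -, -, rfl⟩ := h.surj b
  obtain ⟨m, hm⟩ := (h.ker (u - n • w)).1 (by rw [map_sub, map_nsmul, hb, sub_self])
  exact ⟨w, m, by rw [← hm]; abel⟩

end IsUnwinding

lemma divisible_of_prime {A : Type*} [AddCommGroup A]
    (hdiv : ∀ p : ℕ, p.Prime → ∀ a : A, ∃ b, a = p • b) (n : ℕ) (hn : n ≠ 0) (a : A) : ∃ b, a = n • b := by
  induction n using Nat.recOnMul generalizing a with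
  | zero => exact absurd rfl hn
  | one => exact ⟨a, (one_smul _ _).symm⟩
  | prime p hp => exact hdiv p hp a
  | mul k l hk hl =>
    obtain ⟨b, rfl⟩ := hk (by rintro rfl; simp at hn) a
    obtain ⟨c, rfl⟩ := hl (by rintro rfl; simp at hn) b
    exact ⟨c, (mul_smul _ _ _).symm⟩

namespace IsUnwinding

variable {A U : Type*} [AddCommGroup A] [AddCommGroup U] [LinearOrder U] [IsOrderedAddMonoid U]
  {O : A → A → A → Prop} {z : U} {π : U →+ A}

lemma zsmul_cases (h : IsUnwinding O z π) (m : ℤ) :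
    (m = 0 ∧ m • z = 0) ∨ (1 ≤ m ∧ z ≤ m • z) ∨ (m ≤ -1 ∧ m • z ≤ -z) := by
  rcases lt_trichotomy m 0 with hm | rfl | hm
  · refine Or.inr (Or.inr ⟨by omega, ?_⟩)
    have := zsmul_le_zsmul_left h.pos.le (show m ≤ -1 by omega)
    simpa using this
  · exact Or.inl ⟨rfl, zero_smul _ _⟩
  · refine Or.inr (Or.inl ⟨by omega, ?_⟩)
    have := zsmul_le_zsmul_left h.pos.le (show 1 ≤ m by omega)
    simpa using this

lemma orient_iff (h : IsUnwinding O z π) {u v : U} (hu : 0 ≤ u) (hu' : u < z) (hv : 0 ≤ v)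
    (hv' : v < z) : O 0 (π u) (π v) ↔ 0 < u ∧ u < v := by
  rw [h.orient]
  constructor
  · rintro ⟨m, n, h1, h2, h3⟩
    have hm := h.zsmul_cases m
    have hn := h.zsmul_cases n
    grind
  · rintro ⟨h1, h2⟩
    exact ⟨0, 0, by simpa using h1, by simpa using h2, by simpa using hv'⟩

/-- The clause on the multiples ic in regular density says that they do not wind around. By
induction, the multiples up to pc of the lift of c stay in (0, z), so the orientation of a, pc, b is
a true inequality in U. -/
lemma exists_nsmul_mem_Ioo_of_window (h : IsUnwinding O z π) (hO : IsOrientation O)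
    (hd : IsRegularlyDense O) {p : ℕ}
    (hp : p.Prime) {a b : U} (ha : 0 < a) (hab : a < b) (hb : b < z) :
    ∃ c, 0 < c ∧ a < p • c ∧ p • c < b := by
  obtain ⟨c', h1, h2⟩ := hd p hp (π a) (π b)
    ((h.orient_iff ha.le (hab.trans hb) (ha.trans hab).le hb).2 ⟨ha, hab⟩)
  obtain ⟨c, hc0, hcz, rfl⟩ := h.surj c'
  have key : ∀ i, i + 1 ≤ p → 0 < (i + 1) • c ∧ (i + 1) • c < z := by
    intro i hi
    induction i with
    | zero =>
      have h3 := h2 1 (by rw [Finset.mem_Icc]; have := hp.two_le; omega)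
      have h4 := (hO.ne_zero _ _ h3).1
      refine ⟨?_, by simpa using hcz⟩
      rcases hc0.eq_or_lt with rfl | hc0
      · simp at h4
      · simpa using hc0
    | succ i ih =>
      obtain ⟨h3, h4⟩ := ih (by omega)
      have h5 := h2 (i + 1) (by rw [Finset.mem_Icc]; omega)
      rw [← map_nsmul, ← map_nsmul, h.orient] at h5
      obtain ⟨m, n, h5, h6, h7⟩ := h5
      have hm := h.zsmul_cases m
      have hn := h.zsmul_cases n
      rw [succ_nsmul _ (i + 1)] at *
      generalize (i + 1) • c = d at *
      grind
  have h3 := key (p - 1) (by have := hp.two_le; omega)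
  rw [Nat.sub_add_cancel hp.one_le] at h3
  rw [← hO.zero_sub_iff, ← map_nsmul, ← map_sub, ← map_sub, h.orient] at h1
  obtain ⟨m, n, h4, h5, h6⟩ := h1
  have hm := h.zsmul_cases m
  have hn := h.zsmul_cases n
  refine ⟨c, ?_, ?_⟩
  · have := key 0 hp.one_le
    simpa using this.1
  · generalize p • c = d at *
    grind

/-- There are arbitrarily small positive elements. -/
lemma exists_between_zero (h : IsUnwinding O z π) (hO : IsOrientation O) (hd : IsRegularlyDense O)
    (hdiv : ∀ p : ℕ, p.Prime → ∀ a : A, ∃ b, a = p • b) [Nontrivial A] {ε : U} (hε : 0 < ε) :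
    ∃ a, 0 < a ∧ a < ε := by
  by_contra! hmin
  obtain ⟨a, ha⟩ := exists_ne (0 : A)
  obtain ⟨b, hb⟩ := hdiv 2 Nat.prime_two a
  obtain ⟨a, ha0, haz, rfl⟩ := h.surj a
  obtain ⟨b, hb0, hbz, rfl⟩ := h.surj b
  have ha0 : 0 < a := ha0.lt_of_ne (by rintro rfl; simp at ha)
  have hb0 : 0 < b := hb0.lt_of_ne (by rintro rfl; simp at hb; exact ha hb)
  have haε := hmin a ha0
  have hbε := hmin b hb0
  have haε' := hmin (z - a) (by grind)
  -- Either 2c from regular density lies between ε and 2ε, and 2c - ε is too small; or z = 2ε and a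
  -- = b = ε is the only choice, so a = 2b maps to π z = 0.
  by_cases h2 : ε + ε < z
  · obtain ⟨c, hc⟩ := h.exists_nsmul_mem_Ioo_of_window hO hd Nat.prime_two hε
      (show ε < ε + ε by grind) h2
    have := hmin (2 • c - ε) (by grind)
    grind
  · have e : z = ε + ε := by grind
    have hae := hmin (a - ε)
    have hbe := hmin (b - ε)
    have h3 : a = b := by grind
    have h4 : a = ε := by grind
    apply ha
    rw [hb, ← map_nsmul, two_nsmul, ← h3, h4, ← e, h.map_turn]

lemma exists_nsmul_mem_Ioo_of_prime (h : IsUnwinding O z π) (hO : IsOrientation O)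
    (hd : IsRegularlyDense O) (hdiv : ∀ p : ℕ, p.Prime → ∀ a : A, ∃ b, a = p • b) [Nontrivial A]
    {p : ℕ} (hp : p.Prime) {u v : U} (huv : u < v) : ∃ w, u < p • w ∧ p • w < v := by
  have small : ∀ ε : U, 0 < ε → ∃ c, 0 < c ∧ p • c < ε := by
    intro ε hε
    obtain ⟨b, hb0, hb⟩ := h.exists_between_zero hO hd hdiv
      (show 0 < min ε z from lt_min hε h.pos)
    obtain ⟨a, ha0, ha⟩ := h.exists_between_zero hO hd hdiv hb0
    obtain ⟨c, hc0, hc⟩ := h.exists_nsmul_mem_Ioo_of_window hO hd hp ha0 ha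
      (hb.trans_le (min_le_right _ _))
    exact ⟨c, hc0, hc.2.trans (hb.trans_le (min_le_left _ _))⟩
  -- As z may fail to be divisible by p, the remainder kz is replaced by kpδ with pδ just below z.
  -- The term pγ outweighs this deficit, because k < p and z - pδ < γ, and it is smaller than v - u.
  obtain ⟨u', m, hu⟩ := h.exists_eq_nsmul_add (hdiv p hp) u
  obtain ⟨k, j, hj, hk⟩ : ∃ (k : ℕ) (j : ℤ), m = j * p + k ∧ k < p :=
    ⟨(m % p).toNat, m / p, by
      have h1 := Int.emod_nonneg m (show (p : ℤ) ≠ 0 by exact_mod_cast hp.ne_zero)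
      have h2 := Int.mul_ediv_add_emod m p
      rw [Int.toNat_of_nonneg h1]; linarith, by
      have h1 := Int.emod_lt_of_pos m (show (0 : ℤ) < p by exact_mod_cast hp.pos)
      have h2 := hp.pos
      omega⟩
  obtain ⟨γ, hγ0, hγ⟩ := small (v - u) (sub_pos.2 huv)
  obtain ⟨η, hη0, hη⟩ := h.exists_between_zero hO hd hdiv
    (show 0 < min γ z from lt_min hγ0 h.pos)
  obtain ⟨t, ht0, ht⟩ := h.exists_between_zero hO hd hdiv hη0
  obtain ⟨hηγ, hηz⟩ := lt_min_iff.1 hη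
  obtain ⟨δ, -, hδ1, hδ2⟩ := h.exists_nsmul_mem_Ioo_of_window hO hd hp
    (show 0 < z - η by grind) (show z - η < z - t by grind) (show z - t < z by grind)
  have e : p • (u' + j • z + k • δ + γ) - u = p • γ - k • (z - p • δ) := by
    rw [hu, hj, add_smul, mul_comm, mul_smul, natCast_zsmul, natCast_zsmul]
    simp only [smul_add, smul_sub, smul_comm p k δ]
    abel
  have h1 : k • (z - p • δ) ≤ k • γ := nsmul_le_nsmul_right (by grind) k
  have h2 : k • γ < p • γ := nsmul_lt_nsmul_left hγ0 hk
  have h3 : 0 ≤ k • (z - p • δ) := nsmul_nonneg (by grind) k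
  exact ⟨u' + j • z + k • δ + γ, by grind, by grind⟩

lemma exists_nsmul_mem_Ioo (h : IsUnwinding O z π) (hO : IsOrientation O)
    (hd : IsRegularlyDense O) (hdiv : ∀ p : ℕ, p.Prime → ∀ a : A, ∃ b, a = p • b) [Nontrivial A]
    (n : ℕ) (hn : n ≠ 0) (u v : U) (huv : u < v) : ∃ w, u < n • w ∧ n • w < v := by
  induction n using Nat.recOnMul generalizing u v with
  | zero => exact absurd rfl hn
  | one =>
    obtain ⟨w, hw⟩ := h.exists_nsmul_mem_Ioo_of_prime hO hd hdiv Nat.prime_two huv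
    exact ⟨2 • w, by simpa using hw⟩
  | prime p hp => exact h.exists_nsmul_mem_Ioo_of_prime hO hd hdiv hp huv
  | mul k l hk hl =>
    have hk0 : k ≠ 0 := by rintro rfl; simp at hn
    have hl0 : l ≠ 0 := by rintro rfl; simp at hn
    -- Two multiples of k in the interval leave room for a multiple of l between their quotients.
    obtain ⟨w, hw, hw'⟩ := hk hk0 u v huv
    obtain ⟨w', h1, h2⟩ := hk hk0 _ v hw'
    obtain ⟨y, hy, hy'⟩ := hl hl0 w w' (lt_of_nsmul_lt_nsmul_right k h1)
    refine ⟨y, ?_, ?_⟩ <;> rw [mul_smul]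
    · exact hw.trans (nsmul_lt_nsmul_right hk0 hy)
    · exact (nsmul_lt_nsmul_right hk0 hy').trans h2

end IsUnwinding
end OrientedGroup

/-! ### Affine functions and piecewise affine relations. -/

namespace OrientedGroup

/-- An affine function on `U ^ ι` with integer coefficients. -/
def IsAffine {ι U : Type*} [Fintype ι] [AddCommGroup U] (f : (ι → U) → U) : Prop :=
  ∃ (k : ι → ℤ) (c : U), ∀ u, f u = ∑ i, k i • u i + c

namespace IsAffine

variable {ι κ U : Type*} [Fintype ι] [Fintype κ] [AddCommGroup U] {f g : (ι → U) → U}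

lemma const (c : U) : IsAffine fun _ : ι → U => c := ⟨0, c, by simp⟩

lemma proj (i : ι) : IsAffine fun u : ι → U => u i := by
  classical
  exact ⟨Pi.single i 1, 0, fun u => by simp [Pi.single_apply, ite_smul]⟩

lemma add (hf : IsAffine f) (hg : IsAffine g) : IsAffine fun u => f u + g u := by
  obtain ⟨k, c, hf⟩ := hf
  obtain ⟨l, d, hg⟩ := hg
  refine ⟨k + l, c + d, fun u => ?_⟩
  simp only [hf, hg, Pi.add_apply, add_smul, Finset.sum_add_distrib]
  abel

lemma zsmul (n : ℤ) (hf : IsAffine f) : IsAffine fun u => n • f u := by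
  obtain ⟨k, c, hf⟩ := hf
  refine ⟨n • k, n • c, fun u => ?_⟩
  simp only [hf, Pi.smul_apply, smul_add, Finset.smul_sum, smul_eq_mul, mul_smul]

lemma nsmul (n : ℕ) (hf : IsAffine f) : IsAffine fun u => n • f u := by
  simpa using hf.zsmul n

lemma neg (hf : IsAffine f) : IsAffine fun u => -f u := by
  simpa using hf.zsmul (-1)

lemma sub (hf : IsAffine f) (hg : IsAffine g) : IsAffine fun u => f u - g u := by
  simpa only [sub_eq_add_neg] using hf.add hg.neg

lemma sum {σ : Type*} (s : Finset σ) {F : σ → (ι → U) → U} (hF : ∀ i ∈ s, IsAffine (F i)) :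
    IsAffine fun u => ∑ i ∈ s, F i u := by
  classical
  induction s using Finset.induction_on with
  | empty => simpa using IsAffine.const 0
  | insert a s ha ih =>
    simp only [Finset.sum_insert ha]
    exact (hF a (by simp)).add (ih fun i hi => hF i (by simp [hi]))

lemma comp (hf : IsAffine f) {F : ι → (κ → U) → U} (hF : ∀ i, IsAffine (F i)) :
    IsAffine fun u => f fun i => F i u := by
  obtain ⟨k, c, hf⟩ := hf
  simp only [hf]
  exact (sum _ fun i _ => (hF i).zsmul (k i)).add (const c)

/-- The dependence of an affine function on one of the variables. -/
lemma exists_option {f : (Option ι → U) → U} (hf : IsAffine f) :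
    ∃ (k : ℤ) (g : (ι → U) → U), IsAffine g ∧
      ∀ u v, f (fun i => Option.elim i v u) = g u + k • v := by
  obtain ⟨k, c, hf⟩ := hf
  refine ⟨k none, fun u => ∑ i, k (some i) • u i + c, ⟨_, c, fun _ => rfl⟩, fun u v => ?_⟩
  simp only [hf, Fintype.sum_option, Option.elim]
  abel

end IsAffine

/-- All functions in `F` have the same sign at `u` and at `v`. -/
def SameSigns {X U : Type*} [Zero U] [LinearOrder U] (F : Set (X → U)) (u v : X) : Prop :=
  ∀ f ∈ F, SignType.sign (f u) = SignType.sign (f v)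

lemma SameSigns.symm {X U : Type*} [Zero U] [LinearOrder U] {F : Set (X → U)} {u v : X}
    (h : SameSigns F u v) : SameSigns F v u := fun f hf => (h f hf).symm

section Sign

variable {U : Type*} [Zero U] [LinearOrder U] {a b : U}

lemma pos_iff_of_sign_eq (h : SignType.sign a = SignType.sign b) : 0 < a ↔ 0 < b := by
  rw [← sign_eq_one_iff, h, sign_eq_one_iff]

lemma neg_iff_of_sign_eq (h : SignType.sign a = SignType.sign b) : a < 0 ↔ b < 0 := by
  rw [← sign_eq_neg_one_iff, h, sign_eq_neg_one_iff]

lemma zero_iff_of_sign_eq (h : SignType.sign a = SignType.sign b) : a = 0 ↔ b = 0 := by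
  rw [← sign_eq_zero_iff, h, sign_eq_zero_iff]

lemma sign_eq_of_iff (h1 : 0 < a ↔ 0 < b) (h2 : a < 0 ↔ b < 0) :
    SignType.sign a = SignType.sign b := by
  simp only [sign_apply, h1, h2]

end Sign

/-- The points of the cube `[0, z) ^ ι`. -/
def InCube {ι U : Type*} [Zero U] [LT U] [LE U] (z : U) (u : ι → U) : Prop :=
  ∀ i, 0 ≤ u i ∧ u i < z

variable {A U : Type*} [AddCommGroup A] [AddCommGroup U] [LinearOrder U]

/-- A relation on `A` is piecewise affine if, for some `D > 0`, its preimage under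
`u ↦ π (D u)` in the cube `[0, z) ^ ι` depends only on the signs of finitely many affine
functions. -/
def IsPiecewiseAffine {ι : Type*} [Fintype ι] (z : U) (π : U →+ A) (R : (ι → A) → Prop) : Prop :=
  ∃ D : ℕ, 0 < D ∧ ∃ F : Set ((ι → U) → U), F.Finite ∧ (∀ f ∈ F, IsAffine f) ∧
    ∀ u v, InCube z u → InCube z v → SameSigns F u v →
      R (fun i => π (D • u i)) → R (fun i => π (D • v i))

namespace IsPiecewiseAffine

variable {ι κ : Type*} [Fintype ι] [Fintype κ] {z : U} {π : U →+ A} {R S : (ι → A) → Prop}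
  {O : A → A → A → Prop}

lemma reindex (e : ι → κ) (hR : IsPiecewiseAffine z π R) :
    IsPiecewiseAffine z π fun x : κ → A => R fun i => x (e i) := by
  obtain ⟨D, hD, F, hF, hFa, hF'⟩ := hR
  refine ⟨D, hD, (fun f u => f fun i => u (e i)) '' F, hF.image _, ?_, ?_⟩
  · rintro _ ⟨f, hf, rfl⟩
    exact (hFa f hf).comp fun i => IsAffine.proj (e i)
  · intro u v hu hv huv
    exact hF' (fun i => u (e i)) (fun i => v (e i)) (fun i => hu _) (fun i => hv _)
      fun f hf => huv _ ⟨f, hf, rfl⟩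

lemma of_forall (H : ∀ x y, R x → R y) : IsPiecewiseAffine z π R :=
  ⟨1, one_pos, ∅, Set.finite_empty, by simp, fun _ _ _ _ _ => H _ _⟩

lemma map_nsmul_sub (h : IsUnwinding O z π) (D n m : ℕ) (u : U) :
    π (D • (n • u - m • z)) = π ((D * n) • u) := by
  rw [smul_sub, map_sub, smul_smul, smul_smul, ← natCast_zsmul (a := z) (D * m), h.map_zsmul_turn,
    sub_zero]

variable [IsOrderedAddMonoid U]

lemma exists_carry (h : IsUnwinding O z π) {n : ℕ} (hn : 0 < n) {u : U} (hu : 0 ≤ u)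
    (hu' : u < z) : ∃ m ∈ Finset.range n, 0 ≤ n • u - m • z ∧ n • u - m • z < z := by
  obtain ⟨m, h1, h2⟩ := h.exists_reduce (n • u)
  have h3 : n • u < n • z := nsmul_lt_nsmul_right hn.ne' hu'
  have h4 : 0 ≤ n • u := nsmul_nonneg hu n
  have hm : 0 ≤ m := by
    by_contra hm
    have := h.zsmul_cases m
    grind
  lift m to ℕ using hm
  rw [natCast_zsmul] at h1 h2
  refine ⟨m, ?_, h1, h2⟩
  rw [Finset.mem_range]
  by_contra! hm
  have := nsmul_le_nsmul_left h.pos.le hm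
  grind

/-- For points with the same signs of suitable affine functions, the products with `n` need the
same correction to return to the cube. -/
lemma exists_carry_functions (h : IsUnwinding O z π) {n : ℕ} (hn : 0 < n)
    {F : Set ((ι → U) → U)} (hF : F.Finite) (hFa : ∀ f ∈ F, IsAffine f) :
    ∃ G : Set ((ι → U) → U), G.Finite ∧ (∀ f ∈ G, IsAffine f) ∧
      ∀ u v, InCube z u → InCube z v → SameSigns G u v → ∃ m : ι → ℕ,
        InCube z (fun i => n • u i - m i • z) ∧ InCube z (fun i => n • v i - m i • z) ∧
        SameSigns F (fun i => n • u i - m i • z) (fun i => n • v i - m i • z) := by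
  classical
  -- The first family fixes the integer part of n u i / z, which needs the comparisons with m z and
  -- (m + 1) z, hence `n + 1`. The second evaluates F at every possible corrected point.
  refine ⟨Set.image2 (fun (i : ι) (m : ℕ) u => n • u i - m • z) Set.univ
      (Finset.range (n + 1)) ∪
    Set.image2 (fun f (m : ι → ℕ) u => f fun i => n • u i - m i • z) F
      ↑(Fintype.piFinset fun _ : ι => Finset.range n), ?_, ?_, ?_⟩
  · exact (Set.finite_univ.image2 _ (Finset.finite_toSet _)).union
      (hF.image2 _ (Finset.finite_toSet _))
  · rintro _ (⟨i, -, m, -, rfl⟩ | ⟨f, hf, m, -, rfl⟩)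
    · exact ((IsAffine.proj i).nsmul n).sub (IsAffine.const _)
    · exact (hFa f hf).comp fun i => ((IsAffine.proj i).nsmul n).sub (IsAffine.const _)
  · intro u v hu hv huv
    choose m hm hm1 hm2 using fun i => exists_carry h hn (hu i).1 (hu i).2
    refine ⟨m, fun i => ⟨hm1 i, hm2 i⟩, fun i => ?_, fun f hf => ?_⟩
    · have hmi := Finset.mem_range.1 (hm i)
      have h1 := neg_iff_of_sign_eq (huv _ (Or.inl ⟨i, trivial, m i, by simp; omega, rfl⟩))
      have h2 := neg_iff_of_sign_eq (huv _ (Or.inl ⟨i, trivial, m i + 1, by simp; omega, rfl⟩))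
      have := hm1 i
      have := hm2 i
      simp only [succ_nsmul] at h1 h2
      grind
    · exact huv _ (Or.inr ⟨f, hf, m, by simpa using hm, rfl⟩)

/-- D may be replaced by any positive multiple Dn: nu returns to the cube after subtraction of
multiples of z, which π kills even after multiplication by D. -/
lemma with_mul (h : IsUnwinding O z π) (hR : IsPiecewiseAffine z π R) :
    ∃ D : ℕ, 0 < D ∧ ∀ n : ℕ, 0 < n → ∃ F : Set ((ι → U) → U), F.Finite ∧ (∀ f ∈ F, IsAffine f) ∧
    ∀ u v, InCube z u → InCube z v → SameSigns F u v →
      R (fun i => π ((D * n) • u i)) → R (fun i => π ((D * n) • v i)) := by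
  obtain ⟨D, hD, F, hF, hFa, hF'⟩ := hR
  refine ⟨D, hD, fun n hn => ?_⟩
  obtain ⟨G, hG, hGa, hG'⟩ := exists_carry_functions h hn hF hFa
  refine ⟨G, hG, hGa, fun u v hu hv huv => ?_⟩
  obtain ⟨m, h1, h2, h3⟩ := hG' u v hu hv huv
  simpa only [map_nsmul_sub h] using hF' _ _ h1 h2 h3

/-- Two piecewise affine relations are so for the same `D`. -/
lemma exists_common (h : IsUnwinding O z π) {S : (κ → A) → Prop} (hR : IsPiecewiseAffine z π R)
    (hS : IsPiecewiseAffine z π S) : ∃ D : ℕ, 0 < D ∧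
      ∃ F : Set ((ι → U) → U), F.Finite ∧ (∀ f ∈ F, IsAffine f) ∧
      ∃ G : Set ((κ → U) → U), G.Finite ∧ (∀ f ∈ G, IsAffine f) ∧
      (∀ u v, InCube z u → InCube z v → SameSigns F u v →
        R (fun i => π (D • u i)) → R (fun i => π (D • v i))) ∧
      (∀ u v, InCube z u → InCube z v → SameSigns G u v →
        S (fun i => π (D • u i)) → S (fun i => π (D • v i))) := by
  obtain ⟨D, hD, hR⟩ := with_mul h hR
  obtain ⟨E, hE, hS⟩ := with_mul h hS
  obtain ⟨F, hF, hFa, hR⟩ := hR E hE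
  obtain ⟨G, hG, hGa, hS⟩ := hS D hD
  rw [mul_comm E D] at hS
  exact ⟨D * E, mul_pos hD hE, F, hF, hFa, G, hG, hGa, hR, hS⟩

lemma imp (h : IsUnwinding O z π) (hR : IsPiecewiseAffine z π R) (hS : IsPiecewiseAffine z π S) :
    IsPiecewiseAffine z π fun x => R x → S x := by
  obtain ⟨D, hD, F, hF, hFa, G, hG, hGa, hR, hS⟩ := exists_common h hR hS
  refine ⟨D, hD, F ∪ G, hF.union hG, ?_, fun u v hu hv huv H hv' => ?_⟩
  · rintro f (hf | hf)
    exacts [hFa f hf, hGa f hf]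
  · exact hS u v hu hv (fun f hf => huv f (Or.inr hf))
      (H (hR v u hv hu (fun f hf => (huv f (Or.inl hf)).symm) hv'))

end IsPiecewiseAffine
end OrientedGroup

/-! ### Quantifier elimination. -/

namespace OrientedGroup

lemma IsAffine.exists_sub_eq_nsmul {ι U : Type*} [Fintype ι] [AddCommGroup U]
    {f : (ι → U) → U} (hf : IsAffine f) (K : ℕ) (x y e : ι → U) :
    ∃ d, f (fun i => K • x i - e i) - f (fun i => K • y i - e i) = K • d := by
  obtain ⟨k, c, hf⟩ := hf
  refine ⟨∑ i, k i • (x i - y i), ?_⟩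
  rw [hf, hf, add_sub_add_right_eq_sub, ← Finset.sum_sub_distrib, Finset.smul_sum]
  refine Finset.sum_congr rfl fun i _ => ?_
  rw [← smul_sub, sub_sub_sub_cancel_right, ← smul_sub, smul_comm]

variable {A U : Type*} [AddCommGroup A] [AddCommGroup U] [LinearOrder U] [IsOrderedAddMonoid U]

lemma sign_eq_of_zsmul {q : ℤ} (hq : q ≠ 0) {a b : U}
    (h : SignType.sign (q • a) = SignType.sign (q • b)) :
    SignType.sign a = SignType.sign b := by
  have h1 := pos_iff_of_sign_eq h
  have h2 := neg_iff_of_sign_eq h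
  rcases hq.lt_or_gt with hq | hq
  · have key : ∀ a : U, (0 < q • a ↔ a < 0) ∧ (q • a < 0 ↔ 0 < a) := fun a => by
      have e : q • a = -((-q) • a) := by simp
      rw [e]
      exact ⟨by rw [neg_pos, smul_neg_iff_of_pos_left (by omega)],
        by rw [neg_lt_zero, smul_pos_iff_of_pos_left (by omega)]⟩
    rw [(key a).1, (key b).1] at h1
    rw [(key a).2, (key b).2] at h2
    exact sign_eq_of_iff h2 h1
  · rw [smul_pos_iff_of_pos_left hq, smul_pos_iff_of_pos_left hq] at h1
    rw [smul_neg_iff_of_pos_left hq, smul_neg_iff_of_pos_left hq] at h2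
    exact sign_eq_of_iff h1 h2

/-- The position of `K v` among finitely many thresholds is realized among thresholds in the same
order, if `K U` is dense and the thresholds that are hit may be hit. -/
lemma exists_same_position {X : Type*} {K : ℕ}
    (hK : ∀ u v : U, u < v → ∃ w, u < K • w ∧ K • w < v)
    {T : Set (X → U)} (hT : T.Finite) {x y : X} {v : U}
    (hxy : ∀ f ∈ T, ∀ g ∈ T, SignType.sign (f x - g x) = SignType.sign (f y - g y))
    (heq : ∀ f ∈ T, K • v = f x → ∃ w, K • w = f y)
    (hlow : ∃ f ∈ T, f x ≤ K • v) (hup : ∃ f ∈ T, K • v ≤ f x) :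
    ∃ w, ∀ f ∈ T, SignType.sign (K • v - f x) = SignType.sign (K • w - f y) := by
  by_cases H : ∃ f ∈ T, K • v = f x
  · obtain ⟨f, hf, hv⟩ := H
    obtain ⟨w, hw⟩ := heq f hf hv
    exact ⟨w, fun g hg => by rw [hv, hw]; exact hxy f hf g hg⟩
  · push Not at H
    have hlow' : (T ∩ {f | f x < K • v}).Nonempty := by
      obtain ⟨f, hf, hfv⟩ := hlow
      exact ⟨f, hf, hfv.lt_of_ne (H f hf).symm⟩
    have hup' : (T ∩ {f | K • v < f x}).Nonempty := by
      obtain ⟨f, hf, hfv⟩ := hup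
      exact ⟨f, hf, hfv.lt_of_ne (H f hf)⟩
    -- The largest threshold below and the smallest above, measured at y. Every Kw strictly between
    -- them has the required position.
    obtain ⟨f, ⟨hf, hfv⟩, hmax⟩ :=
      Set.exists_max_image _ (fun f => f y) (hT.subset Set.inter_subset_left) hlow'
    obtain ⟨g, ⟨hg, hgv⟩, hmin⟩ :=
      Set.exists_min_image _ (fun f => f y) (hT.subset Set.inter_subset_left) hup'
    have hfg := neg_iff_of_sign_eq (hxy f hf g hg)
    rw [sub_neg, sub_neg] at hfg
    obtain ⟨w, hw1, hw2⟩ := hK _ _ (hfg.1 (lt_trans hfv hgv))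
    refine ⟨w, fun r hr => ?_⟩
    rcases (H r hr).lt_or_gt with hrv | hrv
    · have := hmin r ⟨hr, hrv⟩
      rw [sign_neg (sub_neg.2 hrv), sign_neg (sub_neg.2 (hw2.trans_le this))]
    · have := hmax r ⟨hr, hrv⟩
      rw [sign_pos (sub_pos.2 hrv), sign_pos (sub_pos.2 (this.trans_lt hw1))]

namespace IsPiecewiseAffine

variable {ι : Type*} [Fintype ι] {z : U} {π : U →+ A} {O : A → A → A → Prop}

/-- Elimination of a quantifier. -/
lemma forall_option (h : IsUnwinding O z π) (hdiv : ∀ n : ℕ, n ≠ 0 → ∀ a : A, ∃ b, a = n • b)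
    (hdense : ∀ n : ℕ, n ≠ 0 → ∀ u v : U, u < v → ∃ w, u < n • w ∧ n • w < v)
    {R : (Option ι → A) → Prop} (hR : IsPiecewiseAffine z π R) :
    IsPiecewiseAffine z π fun x : ι → A => ∀ a, R fun i => Option.elim i a x := by
  classical
  obtain ⟨D, hD, F, hF, hFa, hF'⟩ := hR
  choose k g hg hfg using fun f : F => (hFa f f.2).exists_option
  have := hF.to_subtype
  have := Fintype.ofFinite F
  -- A common multiple of the nonzero coefficients of v, so that each f that involves v compares Kv
  -- with a threshold.
  obtain ⟨K, hK, hKk⟩ : ∃ K : ℕ, 0 < K ∧ ∀ f, k f ≠ 0 → k f ∣ K := by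
    refine ⟨∏ f, if k f = 0 then 1 else (k f).natAbs, ?_, fun f hf => ?_⟩
    · refine Finset.prod_pos fun f _ => ?_
      split_ifs <;> omega
    · rw [← Int.natAbs_dvd, Int.natCast_dvd_natCast]
      refine dvd_trans ?_ (Finset.dvd_prod_of_mem _ (Finset.mem_univ f))
      rw [if_neg hf]
  -- The thresholds 0 and Kz force the transferred point into [0, z).
  let T : Set ((ι → U) → U) :=
    insert (fun _ => 0) (insert (fun _ => K • z) (Set.range fun f u => -((K / k f) • g f u)))
  have hT : T.Finite := ((Set.finite_range _).insert _).insert _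
  have hTa : ∀ f ∈ T, IsAffine f := by
    rintro _ (rfl | rfl | ⟨f, rfl⟩)
    exacts [IsAffine.const _, IsAffine.const _, ((hg f).zsmul _).neg]
  obtain ⟨G, hG, hGa, hG'⟩ := exists_carry_functions h hK
    (F := Set.range g ∪ Set.image2 (fun s t u => s u - t u) T T)
    ((Set.finite_range g).union (hT.image2 _ hT)) (by
      rintro _ (⟨f, rfl⟩ | ⟨s, hs, t, ht, rfl⟩)
      exacts [hg f, (hTa s hs).sub (hTa t ht)])
  refine ⟨D * K, mul_pos hD hK, G, hG, hGa, fun x y hx hy hxy H a => ?_⟩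
  obtain ⟨m, hm1, hm2, hm⟩ := hG' x y hx hy hxy
  obtain ⟨a, rfl⟩ := hdiv D hD.ne' a
  obtain ⟨v, hv0, hvz, rfl⟩ := h.surj a
  -- The relation is known at x for all a and wanted at y, so the witness v over y is carried back
  -- to some w over x. Since both points get the same correction m, each threshold changes by a
  -- multiple of K, and one hit at y can be hit at x.
  obtain ⟨w, hw⟩ := exists_same_position (hdense K hK.ne') hT
    (x := fun i => K • y i - m i • z) (y := fun i => K • x i - m i • z) (v := v)
    (fun s hs t ht => (hm _ (Or.inr ⟨s, hs, t, ht, rfl⟩)).symm)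
    (fun s hs hsv => by
      obtain ⟨d, hd⟩ := (hTa s hs).exists_sub_eq_nsmul K y x fun i => m i • z
      exact ⟨v - d, by rw [smul_sub, ← hd, hsv, sub_sub_cancel]⟩)
    ⟨_, Or.inl rfl, nsmul_nonneg hv0 K⟩
    ⟨_, Or.inr (Or.inl rfl), nsmul_le_nsmul_right hvz.le K⟩
  have hw0 : 0 ≤ w := by
    have := neg_iff_of_sign_eq (hw _ (Or.inl rfl))
    simp only [sub_zero] at this
    by_contra! hw0
    have h1 := this.2 (by simpa using nsmul_lt_nsmul_right hK.ne' hw0)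
    exact absurd (nsmul_nonneg hv0 K) (not_le.2 h1)
  have hwz : w < z := by
    have := neg_iff_of_sign_eq (hw _ (Or.inr (Or.inl rfl)))
    simp only [sub_neg] at this
    exact lt_of_nsmul_lt_nsmul_right K (this.1 (nsmul_lt_nsmul_right hK.ne' hvz))
  have key := hF' (fun i => Option.elim i w fun i => K • x i - m i • z)
    (fun i => Option.elim i v fun i => K • y i - m i • z) ?_ ?_ ?_ ?_
  · convert key using 2 with i
    cases i with
    | none => exact (map_nsmul _ _ _).symm
    | some i => exact (map_nsmul_sub h _ _ _ _).symm
  · rintro (_ | i)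
    exacts [⟨hw0, hwz⟩, hm1 i]
  · rintro (_ | i)
    exacts [⟨hv0, hvz⟩, hm2 i]
  · intro f hf
    have e : ∀ u v, f (fun i => Option.elim i v u) = g ⟨f, hf⟩ u + k ⟨f, hf⟩ • v := hfg ⟨f, hf⟩
    rw [e, e]
    by_cases hk : k ⟨f, hf⟩ = 0
    · rw [hk, zero_smul, zero_smul, add_zero, add_zero]
      exact hm _ (Or.inl ⟨_, rfl⟩)
    -- With K = kq, q(g + kv) = Kv - (-(q g)), so the sign of f is that of Kv relative to its
    -- threshold, up to the sign of q.
    · obtain ⟨q, hq⟩ := hKk _ hk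
      have hq' : (K : ℤ) / k ⟨f, hf⟩ = q := by rw [hq, Int.mul_ediv_cancel_left _ hk]
      have hq0 : q ≠ 0 := by
        rintro rfl
        simp at hq
        omega
      apply sign_eq_of_zsmul hq0
      have := hw _ (Or.inr (Or.inr ⟨⟨f, hf⟩, rfl⟩))
      dsimp only at this
      rw [hq', sub_neg_eq_add, sub_neg_eq_add, ← natCast_zsmul, ← natCast_zsmul, hq] at this
      convert this.symm using 2 <;> rw [smul_add, smul_smul, mul_comm q, add_comm]
  · convert H (π (D • w)) using 2 with i
    cases i with
    | none => rfl
    | some i => exact map_nsmul_sub h _ _ _ _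

end IsPiecewiseAffine
end OrientedGroup

namespace OrientedGroup

/-! ### Definable relations are piecewise affine -/

section Definable

variable {A U : Type*} [AddCommGroup A] [AddCommGroup U] [LinearOrder U] [IsOrderedAddMonoid U]
  {ι : Type*} [Fintype ι] {z : U} {π : U →+ A} {O : A → A → A → Prop}

/-- An affine function with values between `-N z` and `N z` on the cube. -/
def IsBoundedAffine (z : U) (f : (ι → U) → U) : Prop :=
  IsAffine f ∧ ∃ N : ℕ, ∀ u, InCube z u → -(N • z) < f u ∧ f u < N • z

namespace IsBoundedAffine

variable {f g : (ι → U) → U}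

lemma add (hf : IsBoundedAffine z f) (hg : IsBoundedAffine z g) :
    IsBoundedAffine z fun u => f u + g u := by
  obtain ⟨hf, N, hN⟩ := hf
  obtain ⟨hg, M, hM⟩ := hg
  refine ⟨hf.add hg, N + M, fun u hu => ?_⟩
  have := hN u hu
  have := hM u hu
  rw [add_smul]
  grind

lemma neg (hf : IsBoundedAffine z f) : IsBoundedAffine z fun u => -f u := by
  obtain ⟨hf, N, hN⟩ := hf
  refine ⟨hf.neg, N, fun u hu => ?_⟩
  have := hN u hu
  grind

lemma sub (hf : IsBoundedAffine z f) (hg : IsBoundedAffine z g) :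
    IsBoundedAffine z fun u => f u - g u := by
  simpa only [sub_eq_add_neg] using hf.add hg.neg

/-- Boundedness leaves finitely many turns to subtract. This keeps the set of affine functions
finite for atomic formulas. -/
lemma exists_finset (h : IsUnwinding O z π) (hf : IsBoundedAffine z f) :
    ∃ s : Finset ℤ, ∀ u, InCube z u → ∀ m : ℤ, 0 ≤ f u - m • z → f u - m • z < z → m ∈ s := by
  obtain ⟨-, N, hN⟩ := hf
  refine ⟨Finset.Icc (-N - 1) N, fun u hu m h1 h2 => ?_⟩
  have h3 := hN u hu
  have h4 := h.zsmul_cases (m - N)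
  have h5 := h.zsmul_cases (m + N + 1)
  rw [sub_smul, natCast_zsmul] at h4
  rw [add_smul, add_smul, natCast_zsmul, one_smul] at h5
  rw [Finset.mem_Icc]
  generalize N • z = y at *
  constructor
  · by_contra hm
    grind
  · by_contra hm
    grind

end IsBoundedAffine

lemma exists_realize_term (h : IsUnwinding O z π) (t : lang.Term ι) :
    ∃ f, IsBoundedAffine z f ∧
      ∀ u, π (f u) = @Term.realize lang A (structureOf O) ι (fun i => π (u i)) t := by
  let _ := structureOf O
  induction t with
  | var i =>
    refine ⟨fun u => u i, ⟨IsAffine.proj i, 1, fun u hu => ?_⟩, fun u => rfl⟩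
    rw [one_smul]
    exact ⟨(neg_neg_iff_pos.2 h.pos).trans_le (hu i).1, (hu i).2⟩
  | func F ts ih =>
    choose f hf hf' using ih
    cases F with
    | zero =>
      refine ⟨fun _ => 0, ⟨IsAffine.const 0, 1, fun u hu => ?_⟩, fun u => map_zero π⟩
      rw [one_smul]
      exact ⟨neg_neg_iff_pos.2 h.pos, h.pos⟩
    | neg =>
      exact ⟨_, (hf 0).neg, fun u => (map_neg _ _).trans (congrArg _ (hf' 0 u))⟩
    | add =>
      exact ⟨_, (hf 0).add (hf 1),
        fun u => (map_add _ _ _).trans (congrArg₂ _ (hf' 0 u) (hf' 1 u))⟩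

namespace IsPiecewiseAffine

lemma of_map_eq_zero (h : IsUnwinding O z π) {R : (ι → A) → Prop} {f : (ι → U) → U}
    (hf : IsBoundedAffine z f) (hR : ∀ u, R (fun i => π (u i)) ↔ π (f u) = 0) :
    IsPiecewiseAffine z π R := by
  obtain ⟨s, hs⟩ := hf.exists_finset h
  refine ⟨1, one_pos, (fun (m : ℤ) u => f u - m • z) '' s, s.finite_toSet.image _, ?_, ?_⟩
  · rintro _ ⟨m, -, rfl⟩
    exact hf.1.sub (IsAffine.const _)
  · intro u v hu hv huv
    simp only [one_smul, hR, h.ker]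
    rintro ⟨m, hm⟩
    have e : f u - m • z = 0 := sub_eq_zero.2 hm
    have hms := hs u hu m e.ge (e.trans_lt h.pos)
    exact ⟨m, sub_eq_zero.1 ((zero_iff_of_sign_eq (huv _ ⟨m, hms, rfl⟩)).1 e)⟩

lemma of_orient (h : IsUnwinding O z π) {R : (ι → A) → Prop} {f g : (ι → U) → U}
    (hf : IsBoundedAffine z f) (hg : IsBoundedAffine z g)
    (hR : ∀ u, R (fun i => π (u i)) ↔ O 0 (π (f u)) (π (g u))) :
    IsPiecewiseAffine z π R := by
  obtain ⟨s, hs⟩ := hf.exists_finset h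
  obtain ⟨t, ht⟩ := hg.exists_finset h
  refine ⟨1, one_pos, (fun (m : ℤ) u => f u - m • z) '' s ∪
    ((fun (n : ℤ) u => z - (g u - n • z)) '' t ∪
    Set.image2 (fun (m n : ℤ) u => (g u - n • z) - (f u - m • z)) s t),
    (s.finite_toSet.image _).union ((t.finite_toSet.image _).union
      (s.finite_toSet.image2 _ t.finite_toSet)), ?_, ?_⟩
  · rintro _ (⟨m, -, rfl⟩ | ⟨n, -, rfl⟩ | ⟨m, -, n, -, rfl⟩)
    · exact hf.1.sub (IsAffine.const _)
    · exact (IsAffine.const _).sub (hg.1.sub (IsAffine.const _))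
    · exact (hg.1.sub (IsAffine.const _)).sub (hf.1.sub (IsAffine.const _))
  · intro u v hu hv huv
    simp only [one_smul, hR, h.orient]
    rintro ⟨m, n, h1, h2, h3⟩
    have hm := hs u hu m h1.le (h2.trans h3)
    have hn := ht u hu n (h1.trans h2).le h3
    have e1 := pos_iff_of_sign_eq (huv _ (Or.inl ⟨m, hm, rfl⟩))
    have e2 := pos_iff_of_sign_eq (huv _ (Or.inr (Or.inr ⟨m, hm, n, hn, rfl⟩)))
    have e3 := pos_iff_of_sign_eq (huv _ (Or.inr (Or.inl ⟨n, hn, rfl⟩)))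
    simp only [sub_pos] at e2 e3
    exact ⟨m, n, e1.1 h1, e2.1 h2, e3.1 h3⟩

theorem of_boundedFormula (h : IsUnwinding O z π) (hO : IsOrientation O)
    (hdiv : ∀ n : ℕ, n ≠ 0 → ∀ a : A, ∃ b, a = n • b)
    (hdense : ∀ n : ℕ, n ≠ 0 → ∀ u v : U, u < v → ∃ w, u < n • w ∧ n • w < v)
    {n : ℕ} (φ : lang.BoundedFormula ι n) :
    IsPiecewiseAffine z π fun x : ι ⊕ Fin n → A =>
      @BoundedFormula.Realize lang A (structureOf O) ι n φ (fun i => x (Sum.inl i))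
        (fun i => x (Sum.inr i)) := by
  let _ := structureOf O
  have elim_eq : ∀ {n : ℕ} (u : ι ⊕ Fin n → U),
      Sum.elim (fun i => π (u (Sum.inl i))) (fun i => π (u (Sum.inr i))) = fun i => π (u i) :=
    fun u => Sum.elim_comp_inl_inr fun i => π (u i)
  induction φ with
  | falsum => exact of_forall fun _ _ h => h
  | equal t₁ t₂ =>
    obtain ⟨f, hf, hf'⟩ := exists_realize_term h t₁
    obtain ⟨g, hg, hg'⟩ := exists_realize_term h t₂
    refine of_map_eq_zero h (hf.sub hg) fun u => ?_
    rw [map_sub, hf', hg', sub_eq_zero]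
    simp only [BoundedFormula.Realize, elim_eq]
  | rel R ts =>
    cases R with
    | orient =>
      choose f hf hf' using fun i => exists_realize_term h (ts i)
      refine of_orient h ((hf 1).sub (hf 0)) ((hf 2).sub (hf 0)) fun u => ?_
      rw [map_sub, map_sub, hO.zero_sub_iff, hf', hf', hf']
      simp only [BoundedFormula.Realize, elim_eq]
      rfl
  | imp φ ψ hφ hψ => exact hφ.imp h hψ
  | @all n φ hφ =>
    -- The last bound variable becomes the quantified coordinate `none`.
    have := forall_option h hdiv hdense (hφ.reindex
      (Sum.elim (fun i => some (Sum.inl i)) (Fin.snoc (fun i => some (Sum.inr i)) none) :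
        ι ⊕ Fin (n + 1) → Option (ι ⊕ Fin n)))
    convert this using 2 with x
    rw [BoundedFormula.Realize]
    refine forall_congr' fun a => ?_
    congr! 1
    ext i
    refine Fin.lastCases ?_ (fun i => ?_) i <;> simp

end IsPiecewiseAffine

end Definable
end OrientedGroup

/-! ### Counting points and excluding patterns. -/

/-- Finitely many points on a line that are separated by the signs of `n` monotone or antitone
functions are at most `2 n + 1` in number. -/
theorem card_le_of_sign_separated {X U σ τ : Type*} [LinearOrder X] [Zero U] [LinearOrder U]
    [Fintype σ] [Fintype τ] (f : σ → X → U) (hf : ∀ s, Monotone (f s) ∨ Antitone (f s)) (P : τ → X)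
    (hP : ∀ p q, (∀ s, SignType.sign (f s (P p)) = SignType.sign (f s (P q))) → p = q) :
    Fintype.card τ ≤ 2 * Fintype.card σ + 1 := by
  classical
  have hcast : ∀ a b : SignType, a ≤ b → (a : ℤ) ≤ b := by decide
  have hinj : ∀ a b : SignType, (a : ℤ) = b → a = b := by decide
  have hbd : ∀ a : SignType, -1 ≤ (a : ℤ) ∧ (a : ℤ) ≤ 1 := by decide
  -- The signs, negated where needed so that all are monotone. Two points with equal sums of θ then
  -- agree in every summand, and the sum takes at most 2n + 1 values.
  let θ : σ → X → ℤ := fun s v =>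
    if Monotone (f s) then (SignType.sign (f s v) : ℤ) else -(SignType.sign (f s v) : ℤ)
  have hmono : ∀ s v w, v ≤ w → θ s v ≤ θ s w := by
    intro s v w hvw
    by_cases hs : Monotone (f s)
    · simp only [θ, if_pos hs]
      exact hcast _ _ (SignType.sign.monotone (hs hvw))
    · simp only [θ, if_neg hs]
      exact neg_le_neg (hcast _ _ (SignType.sign.monotone ((hf s).resolve_left hs hvw)))
  have hsep : ∀ p q, P p ≤ P q → ∑ s, θ s (P p) = ∑ s, θ s (P q) → p = q := by
    intro p q hpq e
    rw [Finset.sum_eq_sum_iff_of_le fun s _ => hmono s _ _ hpq] at e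
    refine hP p q fun s => hinj _ _ ?_
    have := e s (Finset.mem_univ s)
    by_cases hs : Monotone (f s)
    · simpa only [θ, if_pos hs] using this
    · simpa only [θ, if_neg hs, neg_inj] using this
  have hmem : ∀ p, ∑ s, θ s (P p) ∈ Finset.Icc (-(Fintype.card σ : ℤ)) (Fintype.card σ) := by
    intro p
    have hθ : ∀ s, -1 ≤ θ s (P p) ∧ θ s (P p) ≤ 1 := by
      intro s
      have := hbd (SignType.sign (f s (P p)))
      simp only [θ]
      split_ifs <;> omega
    rw [Finset.mem_Icc]
    constructor
    · have := Finset.card_nsmul_le_sum Finset.univ (fun s => θ s (P p)) (-1) fun s _ => (hθ s).1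
      simpa using this
    · have := Finset.sum_le_card_nsmul Finset.univ (fun s => θ s (P p)) 1 fun s _ => (hθ s).2
      simpa using this
  have := Finset.card_le_card_of_injOn (s := Finset.univ) (fun p => ∑ s, θ s (P p))
    (fun p _ => hmem p) (by
      intro p _ q _ e
      rcases le_total (P p) (P q) with H | H
      · exact hsep p q H e
      · exact (hsep q p H e.symm).symm)
  rw [Finset.card_univ, Int.card_Icc] at this
  omega

namespace OrientedGroup

section Pattern

variable {A U : Type*} [AddCommGroup A] [AddCommGroup U] [LinearOrder U] [IsOrderedAddMonoid U]
  {ι κ : Type*} [Fintype ι] [Fintype κ] {z : U} {π : U →+ A} {O : A → A → A → Prop}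

lemma IsAffine.monotone_or_antitone {f : (Option ι → U) → U} (hf : IsAffine f) (u : ι → U) :
    (Monotone fun v => f fun i => Option.elim i v u) ∨
      Antitone fun v => f fun i => Option.elim i v u := by
  obtain ⟨k, g, -, hfg⟩ := hf.exists_option
  simp only [hfg]
  rcases le_total 0 k with hk | hk
  · exact Or.inl fun v w hvw => add_le_add_right (zsmul_le_zsmul_right hk hvw) _
  · refine Or.inr fun v w hvw => ?_
    have := zsmul_le_zsmul_right (neg_nonneg.2 hk) hvw
    rw [neg_smul, neg_smul, neg_le_neg_iff] at this
    exact add_le_add_right this _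

theorem IsPiecewiseAffine.not_pattern (h : IsUnwinding O z π)
    (hdiv : ∀ n : ℕ, n ≠ 0 → ∀ a : A, ∃ b, a = n • b)
    {R : (Option ι → A) → Prop} {S : (Option κ → A) → Prop} (hR : IsPiecewiseAffine z π R)
    (hS : IsPiecewiseAffine z π S) (a : ℕ → ι → A) (b : ℕ → κ → A) :
    ¬ ∀ (i j : ℕ) (s : Finset ℕ), ∃ x : A,
      R (fun t => Option.elim t x (a i)) ∧ S (fun t => Option.elim t x (b j)) ∧
      (∀ k ∈ s, k ≠ i → ¬ R (fun t => Option.elim t x (a k))) ∧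
      (∀ l ∈ s, l ≠ j → ¬ S (fun t => Option.elim t x (b l))) := by
  intro H
  obtain ⟨D, hD, F, hF, hFa, G, hG, hGa, hR, hS⟩ := exists_common h hR hS
  have lift : ∀ x : A, ∃ v, (0 ≤ v ∧ v < z) ∧ π (D • v) = x := by
    intro x
    obtain ⟨y, rfl⟩ := hdiv D hD.ne' x
    obtain ⟨v, hv0, hvz, rfl⟩ := h.surj y
    exact ⟨v, ⟨hv0, hvz⟩, map_nsmul _ _ _⟩
  choose ℓ hℓ hℓ' using lift
  have hFf := hF.fintype
  have hGf := hG.fintype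
  -- With c = |F| + |G|, this makes N² = 2cN + 2N exceed 2cN + 1.
  obtain ⟨N, hN⟩ : ∃ N, N = 2 * (Fintype.card F + Fintype.card G) + 2 := ⟨_, rfl⟩
  choose x hxR hxS hxR' hxS' using fun i j => H i j (Finset.range N)
  have hRiff : ∀ i x y, (∀ f ∈ F, SignType.sign (f fun t => Option.elim t (ℓ x) fun k => ℓ (a i k)) =
      SignType.sign (f fun t => Option.elim t (ℓ y) fun k => ℓ (a i k))) →
      R (fun t => Option.elim t x (a i)) → R (fun t => Option.elim t y (a i)) := by
    intro i x y hxy hx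
    have := hR (fun t => Option.elim t (ℓ x) fun k => ℓ (a i k))
      (fun t => Option.elim t (ℓ y) fun k => ℓ (a i k))
      (by rintro (_ | t); exacts [hℓ _, hℓ _]) (by rintro (_ | t); exacts [hℓ _, hℓ _]) hxy
    convert this ?_ using 2 with t
    · cases t <;> exact (hℓ' _).symm
    · convert hx using 2 with t
      cases t <;> exact hℓ' _
  have hSiff : ∀ i x y, (∀ f ∈ G, SignType.sign (f fun t => Option.elim t (ℓ x) fun k => ℓ (b i k)) =
      SignType.sign (f fun t => Option.elim t (ℓ y) fun k => ℓ (b i k))) →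
      S (fun t => Option.elim t x (b i)) → S (fun t => Option.elim t y (b i)) := by
    intro i x y hxy hx
    have := hS (fun t => Option.elim t (ℓ x) fun k => ℓ (b i k))
      (fun t => Option.elim t (ℓ y) fun k => ℓ (b i k))
      (by rintro (_ | t); exacts [hℓ _, hℓ _]) (by rintro (_ | t); exacts [hℓ _, hℓ _]) hxy
    convert this ?_ using 2 with t
    · cases t <;> exact (hℓ' _).symm
    · convert hx using 2 with t
      cases t <;> exact hℓ' _
  have key := card_le_of_sign_separated (σ := F × Fin N ⊕ G × Fin N) (τ := Fin N × Fin N)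
    (Sum.elim (fun s v => s.1.1 fun t => Option.elim t v fun k => ℓ (a s.2 k))
      (fun s v => s.1.1 fun t => Option.elim t v fun k => ℓ (b s.2 k)))
    (by
      rintro (s | s)
      · exact (hFa _ s.1.2).monotone_or_antitone _
      · exact (hGa _ s.1.2).monotone_or_antitone _)
    (fun p => ℓ (x p.1 p.2)) (by
      -- Equal signs carry the instances of R and S that hold at p over to q, where only the
      -- instances with q's own indices hold.
      intro p q hpq
      have h1 := hRiff p.1 (x p.1 p.2) (x q.1 q.2)
        (fun f hf => hpq (Sum.inl (⟨f, hf⟩, p.1))) (hxR _ _)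
      have h2 := hSiff p.2 (x p.1 p.2) (x q.1 q.2)
        (fun f hf => hpq (Sum.inr (⟨f, hf⟩, p.2))) (hxS _ _)
      refine Prod.ext (Fin.ext ?_) (Fin.ext ?_)
      · by_contra hne
        exact hxR' _ _ _ (Finset.mem_range.2 p.1.2) hne h1
      · by_contra hne
        exact hxS' _ _ _ (Finset.mem_range.2 p.2.2) hne h2)
  simp only [Fintype.card_sum, Fintype.card_prod, Fintype.card_fin] at key
  nlinarith

end Pattern

/-- A divisible, regularly dense oriented abelian group has no ICT-pattern. -/
theorem not_isICTPattern {A : Type*} [AddCommGroup A] {O : A → A → A → Prop}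
    (hO : IsOrientation O) (hd : IsRegularlyDense O)
    (hdiv : ∀ p : ℕ, p.Prime → ∀ a : A, ∃ b, a = p • b) {m n : ℕ}
    (φ : lang.Formula (Unit ⊕ Fin m)) (ψ : lang.Formula (Unit ⊕ Fin n))
    (a : ℕ → Fin m → A) (b : ℕ → Fin n → A) :
    ¬ @IsICTPattern lang A (structureOf O) m n φ ψ a b := by
  let _ := structureOf O
  intro H
  -- The density results fail for the trivial group, which has too few points for a pattern.
  rcases subsingleton_or_nontrivial A with _ | _
  · obtain ⟨x, -, -, hx, -⟩ := H 0 0 {1}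
    obtain ⟨y, hy, -⟩ := H 1 0 ∅
    rw [Subsingleton.elim y x] at hy
    exact hx 1 (Finset.mem_singleton_self 1) one_ne_zero hy
  have h := Unwinding.isUnwinding hO
  have hdiv' := divisible_of_prime hdiv
  have key : ∀ {m : ℕ} (φ : lang.Formula (Unit ⊕ Fin m)),
      IsPiecewiseAffine (Unwinding.turn hO) (Unwinding.proj hO) fun x : Option (Fin m) → A =>
        φ.Realize (Sum.elim (fun _ => x none) fun i => x (some i)) := by
    intro m φ
    have := (IsPiecewiseAffine.of_boundedFormula h hO hdiv'
      (h.exists_nsmul_mem_Ioo hO hd hdiv) φ).reindex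
      (Sum.elim (Sum.elim (fun _ => none) some) Fin.elim0 :
        (Unit ⊕ Fin m) ⊕ Fin 0 → Option (Fin m))
    convert this using 2 with x
    rw [Formula.Realize]
    congr! 1
    ext (i | i) <;> rfl
  exact (key φ).not_pattern h hdiv' (key ψ) a b H

end OrientedGroup

theorem mainTheorem8 (ε : ℕ∞) (hε : ε = 0 ∨ ε = ⊤) :
    Theory.DPMinimal.{0, 0, w} (OrientedGroup.theory (fun _ => 0) (fun _ => ε)) := by
  rintro M s hM ⟨m, n, φ, ψ, a, b, H⟩
  have hg : M ⊨ OrientedGroup.groupAxioms := by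
    simp only [OrientedGroup.theory, Theory.model_union_iff] at hM
    exact hM.1.1.1.1.1.1
  obtain ⟨_, O, rfl⟩ := OrientedGroup.exists_eq_structureOf hg
  obtain ⟨hO, hd, hcard, -⟩ := (OrientedGroup.model_theory_iff O _ _).1 hM
  refine OrientedGroup.not_isICTPattern hO hd (fun p hp x => ?_) φ ψ a b H
  -- d_p = 0 gives |M/pM| = p⁰ = 1, that is, divisibility by p.
  have h1 : ENat.card (M ⧸ (nsmulAddMonoidHom (α := M) p).range) = 1 := by
    rw [hcard ⟨p, hp⟩]
    change ((p ^ 0 : ℕ) : ℕ∞) = 1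
    simp
  rw [ENat.card_eq_one_iff_unique] at h1
  obtain ⟨_⟩ := h1
  have h2 : x ∈ (nsmulAddMonoidHom (α := M) p).range := by
    rw [← QuotientAddGroup.eq_zero_iff]
    exact Subsingleton.elim _ _
  obtain ⟨y, hy⟩ := h2
  exact ⟨y, hy.symm⟩
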